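/- **Channel.** For non-negative integers $n_d,n_c,n_r,n_s$ let $q=\max\{n_d,n_c,n_r,n_s\}$ and let $S$ be the $q\times q$ down-shift matrix over $\mathbb F_2$. In the symmetric linear-deterministic interference relay channel, transmitter $i\in\{1,2\}$ sends $x_i[k]\in\mathbb F_2^q$ in channel use $k$, the relay receives $y_r[k]=S^{q-n_s}x_1[k]\oplus S^{q-n_s}x_2[k]$ and sends $x_r[k]$, a function of $y_r[1],\dots,y_r[k-1]$ (with $x_r[1]=0$), and receiver $j$ receives $y_j[k]=S^{q-n_d}x_j[k]\oplus S^{q-n_c}x_l[k]\oplus S^{q-n_r}x_r[k]$, $l\neq j$. A pair $(R_1,R_2)$ of non-negative rates is achievable if there are $(n,\lfloor2^{nR_1}\rfloor,\lfloor2^{nR_2}\rfloor)$ codes with average error probability tending to $0$ as $n\to\infty$; a sum-rate $R$ is achievable if for every $\varepsilon>0$ there is an achievable pair with $R_1+R_2\ge R-\varepsilon$. **Scheme WI-3.** Transmission takes place in $N$ blocks of $T\ge1$ channel uses; the $T$ vectors of a block are interleaved level by level into one vector of $Tq$ bits. In block $k$ transmitter $i$ sends, from top to bottom, $$\big(u_{i,cm1}[k],\,u_{i,cm2}[k],\,u_{i,cn1}[k-1],\,u_{i,cn2}[k-1],\,u_{i,p1}[k],\,0_{\ell_1^u},\,u_{i,cn1}[k],\,0_{\ell_1^d},\,u_{i,cn3}[k-1],\,u_{i,p2}[k],\,u_{i,cn2}[k],\,u_{i,cn3}[k],\,0\big),$$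 and the relay sends $$\big(0_{\ell_2},\,u_{r,cn1}[k],\,u_{r,cn2}[k],\,0_{\ell_3},\,u_{r,cn3}[k],\,0\big),\qquad u_{r,a}[k]=u_{1,a}[k-1]\oplus u_{2,a}[k-1]$$ (cooperative neutralization), where all $u_{i,a}[0]$ and $u_{i,a}[N]$ are zero. The block lengths do not depend on $k$ or $N$; those sent by a transmitter add up to at most $Tq$, and $R_{cn1}+R_{cn2}+R_{cn3}+\ell_2+\ell_3\le Tn_r$; and either $R_{cn3}=\ell_3=0$, or $R_{cn3}>0$ and $R_{cn1}=R_{p1}=0$, where $R_a$ is the length of $u_{i,a}$. The signals $cm2,cn1,cn2,cn3,p1,p2$ carry independent uncoded information bits, and $cm1$ is a codeword, taken from a codebook over the blocks. Receiver $i$ decodes the whole message of user $i$ and also the common signals $cm1,cm2$ of the other user. Scheme WI-3 achieves the sum-rate $R$ if, for some fixed $T$ and block lengths, there are such codes for all $N$ whose sum-rates (in bits per channel use) tend to $R$ and whose average error probabilities tend to $0$ as $N\to\infty$. **Proposition.** Let $n_c<n_d$. Scheme WI-3 achieves the sum-rate $$R=\begin{cases} \min\{n_s+n_d-n_c,\;2n_d+n_r-n_c,\;2\max\{n_c,n_r+n_d-n_c\}\}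 & \text{if } n_r\le n_c<n_d\le n_s,\\ \min\{2n_d-n_c,\;2\max\{n_s,n_d-n_c\},\;2\max\{n_c,n_r+n_d-n_c\}\} & \text{if } n_r\le n_c\le n_s\le n_d,\\ \min\{2n_d-n_c,\;2\max\{n_r+n_s-n_c,n_d-n_c\}\} & \text{if } n_c\le n_r\le n_s\le n_d<n_s+\tfrac{n_c}{2}. \end{cases}$$ In particular this sum-rate is achievable. In each of the three regimes: 1. if $n_s>n_c$, then $R$ equals the capacity expression $$\min\left\{\begin{array}{l}2\max\{n_d,n_r\}\\ \max\{n_d,n_c,n_r\}+\max\{n_d,n_c\}-\big(n_c-(n_s-\max\{n_d,n_c\})^+\big)^+\\ n_r+2\max\{n_d,n_c\}-n_c\\ 2\max\{n_s,n_r+n_s-n_c,n_d-n_c\}\\ \max\{n_d,n_c\}+\max\{n_d,n_s\}\\ 2\max\{n_c,n_r+(n_d-n_c)^+\}\end{array}\right\};$$ 2. $R$ equals the minimum of the expressions $\max\{n_d,n_c,n_r\}+\max\{n_d,n_c\}$; $n_r+2\max\{n_d,n_c\}-n_c$; $\max\{n_d,n_c\}+\max\{n_d,n_s\}$; $2\max\{n_c,n_r,n_d-\max\{n_c,n_s\}\}+2(n_s-n_c)^+$;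 $2\max\{n_d,n_r\}$; $\max\{n_d,n_r,n_c\}+\max\{n_d,n_c\}-n_c+(n_s-\max\{n_d,n_c\})^+$; and, if $n_r\le n_c\le n_d$, also $2\max\{n_c,n_r+n_d-n_c\}$. Moreover, if $n_c<n_d$ and $n_c<n_s$, then the parameters lie in one of the three regimes above, or in one of the four regimes $n_c<n_d\le n_s\le n_r$; $n_c\le n_s\le n_d\le n_r$; $n_c<n_d\le n_r\le n_s$; $n_c\le n_r\le n_d\le n_s$ (of scheme WI-1), or in one of the two regimes $n_c\le n_s\le n_r\le n_d$; $n_c\le n_r\le n_s\le n_d-\frac{n_c}{2}$ (of scheme WI-2). -/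

import Mathlib

open Filter Topology
open scoped Matrix

namespace LDIRC

/-- Channel strengths of the symmetric linear-deterministic interference relay channel: direct
links `nd`, cross links `nc`, relay-destination links `nr`, source-relay links `ns`. -/
structure Params where
  nd : ℕ
  nc : ℕ
  nr : ℕ
  ns : ℕ

/-- The length of the input vectors. -/
def Params.q (P : Params) : ℕ := max (max P.nd P.nc) (max P.nr P.ns)

/-- Binary vectors of length `m` (index `0` is the top-most bit). -/
abbrev Bits (m : ℕ) : Type := Fin m → ZMod 2

/-- The `q × q` down-shift matrix over `𝔽₂`. -/
def downShift (q : ℕ) : Matrix (Fin q) (Fin q) (ZMod 2) :=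
  Matrix.of fun i j => if (i : ℕ) = (j : ℕ) + 1 then 1 else 0

/-- The signal received by the relay in one channel use. -/
def Params.relayOutput (P : Params) (x : Fin 2 → Bits P.q) : Bits P.q :=
  (downShift P.q ^ (P.q - P.ns)) *ᵥ x 0 + (downShift P.q ^ (P.q - P.ns)) *ᵥ x 1

/-- The signal received by receiver `j` in one channel use; `1 - j` is the other user. -/
def Params.rxOutput (P : Params) (x : Fin 2 → Bits P.q) (xr : Bits P.q) (j : Fin 2) : Bits P.q :=
  (downShift P.q ^ (P.q - P.nd)) *ᵥ x j + (downShift P.q ^ (P.q - P.nc)) *ᵥ x (1 - j)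
    + (downShift P.q ^ (P.q - P.nr)) *ᵥ xr

/-- A code of length `n` with message sets `W 0`, `W 1`. The relay is causal and full-duplex: its
input in channel use `k` is a function of its outputs in the earlier channel uses, and it is silent
in the first channel use. (Channel uses are numbered from `0`.) -/
structure Code (P : Params) (n : ℕ) (W : Fin 2 → Type) where
  enc : (i : Fin 2) → W i → Fin n → Bits P.q
  relay : (k : Fin n) → (Fin (k : ℕ) → Bits P.q) → Bits P.q
  relay_first : ∀ k : Fin n, (k : ℕ) = 0 → ∀ y, relay k y = 0
  dec : (i : Fin 2) → (Fin n → Bits P.q) → W i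

namespace Code

variable {P : Params} {n : ℕ} {W : Fin 2 → Type}

/-- The relay output in channel use `k` when the messages are `w`. -/
def relayRx (C : Code P n W) (w : (i : Fin 2) → W i) (k : Fin n) : Bits P.q :=
  P.relayOutput fun i => C.enc i (w i) k

/-- The relay input in channel use `k` when the messages are `w`. -/
def relayTx (C : Code P n W) (w : (i : Fin 2) → W i) (k : Fin n) : Bits P.q :=
  C.relay k fun j => C.relayRx w ⟨j, j.isLt.trans k.isLt⟩

/-- The sequence received by receiver `j` when the messages are `w`. -/
def rx (C : Code P n W) (w : (i : Fin 2) → W i) (j : Fin 2) : Fin n → Bits P.q :=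
  fun k => P.rxOutput (fun i => C.enc i (w i) k) (C.relayTx w k) j

/-- Average error probability: the fraction of message pairs for which some receiver errs. -/
noncomputable def errorProb (C : Code P n W) : ℝ :=
  (Set.ncard {w : (i : Fin 2) → W i | ∃ i, C.dec i (C.rx w i) ≠ w i} : ℝ) /
    (Nat.card ((i : Fin 2) → W i) : ℝ)

end Code

/-- A rate pair is achievable if there is a sequence of `(n, 2^{n R₁}, 2^{n R₂})` codes whose
average error probability tends to zero. -/
def Params.Achievable (P : Params) (R : Fin 2 → ℝ) : Prop :=
  (∀ i, 0 ≤ R i) ∧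
    ∃ C : (n : ℕ) → Code P n (fun i => Fin ⌊(2 : ℝ) ^ ((n : ℝ) * R i)⌋₊),
      Tendsto (fun n => (C n).errorProb) atTop (𝓝 0)

/-- The sum-rate `R` is achievable: achievable rate pairs have sum-rates arbitrarily close to `R`
or above, i.e. `R` does not exceed the sum-capacity. -/
def Params.SumRateAchievable (P : Params) (R : ℝ) : Prop :=
  ∀ ε : ℝ, 0 < ε → ∃ r : Fin 2 → ℝ, P.Achievable r ∧ R - ε ≤ r 0 + r 1

/-! ### Scheme WI-3 -/

/-- The uncoded bit streams of scheme WI-3: second common stream, three streams for cooperative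
neutralization, two private streams. -/
inductive Stream
  | cm2
  | cn1
  | cn2
  | cn3
  | p1
  | p2

/-- The block lengths of scheme WI-3: `len a` is the length `R_a` of a block of stream `a`, `lcm1` is
the length of a block of the coded first common signal, the others are lengths of zero blocks. -/
structure Lengths where
  len : Stream → ℕ
  lcm1 : ℕ
  l1u : ℕ
  l1d : ℕ
  l2 : ℕ
  l3 : ℕ

/-- The signals fit into the input vectors of `T` channel uses (`T * q` bits), and the scheme is of
one of the two variants WI3a (no third neutralization stream) and WI3b. -/
def Lengths.Valid (L : Lengths) (P : Params) (T : ℕ) : Prop :=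
  L.lcm1 + L.len .cm2 + 2 * L.len .cn1 + 2 * L.len .cn2 + 2 * L.len .cn3 + L.len .p1 + L.len .p2
      + (L.l1u + L.l1d) ≤ T * P.q ∧
    L.len .cn1 + L.len .cn2 + L.len .cn3 + L.l2 + L.l3 ≤ T * P.nr ∧
    ((L.len .cn3 = 0 ∧ L.l3 = 0) ∨ (0 < L.len .cn3 ∧ L.len .cn1 = 0 ∧ L.len .p1 = 0))

/-- A message of one user: the index of a codeword of the first common signal, and `B` blocks of
independent bits of every stream. -/
abbrev Msg (L : Lengths) (B M : ℕ) : Type :=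
  Fin M × ((a : Stream) → Fin B → Bits (L.len a))

/-- The block `u[k]` of `u[1], …, u[B]`, which is the zero vector for `k = 0` and for `k > B`. -/
def block {B m : ℕ} (u : Fin B → Bits m) (k : ℕ) : Bits m :=
  if h : 1 ≤ k ∧ k ≤ B then u ⟨k - 1, by omega⟩ else 0

/-- The vector that a transmitter sends in the `k`-th block, `k = 1, …, B + 1`, from top to bottom
and without the zeros that fill it up to full length. -/
def txStack (L : Lengths) {B : ℕ} (c : Fin B → Bits L.lcm1)
    (u : (a : Stream) → Fin B → Bits (L.len a)) (k : ℕ) : List (ZMod 2) :=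
  List.ofFn (block c k) ++
  List.ofFn (block (u .cm2) k) ++
  List.ofFn (block (u .cn1) (k - 1)) ++
  List.ofFn (block (u .cn2) (k - 1)) ++
  List.ofFn (block (u .p1) k) ++
  List.replicate L.l1u 0 ++
  List.ofFn (block (u .cn1) k) ++
  List.replicate L.l1d 0 ++
  List.ofFn (block (u .cn3) (k - 1)) ++
  List.ofFn (block (u .p2) k) ++
  List.ofFn (block (u .cn2) k) ++
  List.ofFn (block (u .cn3) k)

/-- The vector that the relay sends in the `k`-th block: the modulo-2 sums of the neutralization
signals of the two users in the block before. -/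
def relayStack (L : Lengths) {B : ℕ} (u : Fin 2 → (a : Stream) → Fin B → Bits (L.len a)) (k : ℕ) :
    List (ZMod 2) :=
  List.replicate L.l2 0 ++
  List.ofFn (block (u 0 .cn1) (k - 1) + block (u 1 .cn1) (k - 1)) ++
  List.ofFn (block (u 0 .cn2) (k - 1) + block (u 1 .cn2) (k - 1)) ++
  List.replicate L.l3 0 ++
  List.ofFn (block (u 0 .cn3) (k - 1) + block (u 1 .cn3) (k - 1))

/-- A code of scheme WI-3 with `B + 1` blocks, each of `T` channel uses. The `T` input vectors of a
block are interleaved into one vector of `T * q` bits: bit `j` of the vector sent in the `t`-th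
channel use of the block (`t = 0, …, T - 1`) is bit `j * T + t` of the block vector. In block `k` the
transmitters send `txStack` and the relay sends `relayStack`. Receiver `i` decodes the message of
user `i` and also the common signals of the other user. -/
structure WI3Code (P : Params) (T : ℕ) (L : Lengths) (B M : ℕ) where
  book : Fin 2 → Fin M → Fin B → Bits L.lcm1
  code : Code P ((B + 1) * T) (fun _ => Msg L B M)
  enc_eq : ∀ i w k j, code.enc i w k j =
    (txStack L (book i w.1) w.2 ((k : ℕ) / T + 1)).getD ((j : ℕ) * T + (k : ℕ) % T) 0
  relay_eq : ∀ w k j, code.relayTx w k j =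
    (relayStack L (fun i => (w i).2) ((k : ℕ) / T + 1)).getD ((j : ℕ) * T + (k : ℕ) % T) 0
  decCommon : Fin 2 → (Fin ((B + 1) * T) → Bits P.q) → Fin M × (Fin B → Bits (L.len .cm2))

/-- Average error probability of a WI-3 code: the fraction of message pairs for which some receiver
errs about its message or about the common signals of the other user. -/
noncomputable def WI3Code.errorProb {P : Params} {T : ℕ} {L : Lengths} {B M : ℕ}
    (C : WI3Code P T L B M) : ℝ :=
  (Set.ncard {w : Fin 2 → Msg L B M | ∃ i, C.code.dec i (C.code.rx w i) ≠ w i ∨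
      C.decCommon i (C.code.rx w i) ≠ ((w (1 - i)).1, (w (1 - i)).2 .cm2)} : ℝ) /
    (Nat.card (Fin 2 → Msg L B M) : ℝ)

/-- The sum-rate, in bits per channel use, of a WI-3 code. -/
noncomputable def wi3SumRate (T : ℕ) (L : Lengths) (B M : ℕ) : ℝ :=
  Real.logb 2 (Nat.card (Fin 2 → Msg L B M)) / (((B + 1) * T : ℕ) : ℝ)

/-- Scheme WI-3 achieves the sum-rate `R`: for some fixed choice of the block lengths there are WI-3
codes, one for every number of blocks, whose sum-rates tend to `R` and whose error probabilities
tend to zero. -/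
def Params.WI3Achieves (P : Params) (R : ℝ) : Prop :=
  ∃ T : ℕ, 0 < T ∧ ∃ L : Lengths, L.Valid P T ∧
    ∃ (M : ℕ → ℕ) (C : (B : ℕ) → WI3Code P T L B (M B)), (∀ B, 0 < M B) ∧
      Tendsto (fun B => wi3SumRate T L B (M B)) atTop (𝓝 R) ∧
      Tendsto (fun B => (C B).errorProb) atTop (𝓝 0)

/-! ### The capacity expression and the outer bounds -/

/-- The sum-capacity expression for `nc < ns`, `nc ≠ nd`. -/
noncomputable def Params.capacityExpr (P : Params) : ℝ :=
  let nd : ℝ := P.nd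
  let nc : ℝ := P.nc
  let nr : ℝ := P.nr
  let ns : ℝ := P.ns
  min (2 * max nd nr)
    (min (max (max nd nc) nr + max nd nc - max (nc - max (ns - max nd nc) 0) 0)
      (min (nr + 2 * max nd nc - nc)
        (min (2 * max ns (max (nr + ns - nc) (nd - nc)))
          (min (max nd nc + max nd ns)
            (2 * max nc (nr + max (nd - nc) 0))))))

/-- The least of the outer bounds on the sum-capacity for `nc ≠ nd`; the last one is a bound only for
`nr ≤ nc ≤ nd`. -/
noncomputable def Params.outerBound (P : Params) : ℝ :=
  let nd : ℝ := P.nd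
  let nc : ℝ := P.nc
  let nr : ℝ := P.nr
  let ns : ℝ := P.ns
  let b : ℝ :=
    min (max (max nd nc) nr + max nd nc)
      (min (nr + 2 * max nd nc - nc)
        (min (max nd nc + max nd ns)
          (min (2 * max (max nc nr) (nd - max nc ns) + 2 * max (ns - nc) 0)
            (min (2 * max nd nr)
              (max (max nd nr) nc + max nd nc - nc + max (ns - max nd nc) 0)))))
  if P.nr ≤ P.nc ∧ P.nc ≤ P.nd then min b (2 * max nc (nr + nd - nc)) else b

/-- The sum-rate `R` is achieved by scheme WI-3, hence achievable, and it is optimal in the sense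
that it coincides with the outer bounds and, if `nc < ns`, with the capacity expression. -/
def Params.WI3Attains (P : Params) (R : ℝ) : Prop :=
  P.WI3Achieves R ∧ P.SumRateAchievable R ∧ R = P.outerBound ∧ (P.nc < P.ns → R = P.capacityExpr)

/-- The regime `n_r ≤ n_c < n_d ≤ n_s`. -/
def Params.RegimeA (P : Params) : Prop := P.nr ≤ P.nc ∧ P.nc < P.nd ∧ P.nd ≤ P.ns

/-- The regime `n_r ≤ n_c ≤ n_s ≤ n_d`. -/
def Params.RegimeB (P : Params) : Prop := P.nr ≤ P.nc ∧ P.nc ≤ P.ns ∧ P.ns ≤ P.nd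

/-- The regime `n_c ≤ n_r ≤ n_s ≤ n_d < n_s + n_c / 2`. -/
def Params.RegimeC (P : Params) : Prop :=
  P.nc ≤ P.nr ∧ P.nr ≤ P.ns ∧ P.ns ≤ P.nd ∧ (P.nd : ℝ) < P.ns + (P.nc : ℝ) / 2

/-- The four regimes of scheme WI-1. -/
def Params.RegimeWI1 (P : Params) : Prop :=
  (P.nc < P.nd ∧ P.nd ≤ P.ns ∧ P.ns ≤ P.nr) ∨ (P.nc ≤ P.ns ∧ P.ns ≤ P.nd ∧ P.nd ≤ P.nr) ∨
    (P.nc < P.nd ∧ P.nd ≤ P.nr ∧ P.nr ≤ P.ns) ∨ (P.nc ≤ P.nr ∧ P.nr ≤ P.nd ∧ P.nd ≤ P.ns)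

/-- The two regimes of scheme WI-2. -/
def Params.RegimeWI2 (P : Params) : Prop :=
  (P.nc ≤ P.ns ∧ P.ns ≤ P.nr ∧ P.nr ≤ P.nd) ∨
    (P.nc ≤ P.nr ∧ P.nr ≤ P.ns ∧ (P.ns : ℝ) ≤ P.nd - (P.nc : ℝ) / 2)

end LDIRC

namespace LDIRC

/-! All signals are linear over 𝔽₂. A choice of block lengths and linear encoders for `cm1` that
passes a kernel test (`LinearScheme`, `DecodableAt`) therefore gives codes with error probability
exactly zero: the relay and the receivers may act on any message pair consistent with what they
received. Only the closing block, which carries no new bits, costs rate. All schemes use T = 2, so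
that the sum-rate equals the number of bits each user sends per block; lengths that are
half-integers per channel use thereby become available.

Cooperative neutralization: a stream is sent once for the relay and repeated one block later at
higher levels. At a receiver the relay's sum is aligned with the interferer's repetition, which it
cancels; the receiver's own repetition remains, and this has already been read further up. Put A =
2(n_d - n_c), the number of top bits of a received block that the other user does not reach. Three
designs carry the proof.

`decodableAt_of_cn1`: the top A bits hold uncoded common bits, the repetitions and `p1`. The
interfering common bits fall on zeros and on new `cn1` bits, which the next block reveals.

`decodableAt_of_coded`: one user sends its common bits once followed by zeros, the other sends them
twice, so that both can be resolved where they overlap; only `cn2` is neutralized.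

`decodableAt_of_cn3`: the uncoded common bits fall on a gap of zeros, and neutralization takes place
above and below the shifted gap.

The lemmas `exists_scheme_cn1`, `exists_scheme_coded` and `exists_scheme_cn3` turn these into
numerical conditions. In each regime a case distinction picks the design that reaches the minimum;
the comparison with the capacity expression and the outer bounds, and the coverage of all regimes,
are linear arithmetic. -/

/-! ### Block-level description of the channel -/

/-- A bit vector, continued by zeros. -/
def pad {m : ℕ} (x : Bits m) (j : ℕ) : ZMod 2 := if h : j < m then x ⟨j, h⟩ else 0

theorem pad_of_lt {m : ℕ} (x : Bits m) {j : ℕ} (h : j < m) : pad x j = x ⟨j, h⟩ := dif_pos h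

theorem pad_of_le {m : ℕ} (x : Bits m) {j : ℕ} (h : m ≤ j) : pad x j = 0 := dif_neg (by omega)

theorem pad_sub {m : ℕ} (x y : Bits m) (j : ℕ) : pad (x - y) j = pad x j - pad y j := by
  unfold pad; split_ifs <;> simp

theorem pad_add {m : ℕ} (x y : Bits m) (j : ℕ) : pad (x + y) j = pad x j + pad y j := by
  unfold pad; split_ifs <;> simp

@[simp] theorem pad_zero {m : ℕ} (j : ℕ) : pad (0 : Bits m) j = 0 := by
  unfold pad; split_ifs <;> simp

theorem eq_zero_of_pad {m : ℕ} {x : Bits m} (h : ∀ j < m, pad x j = 0) : x = 0 := by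
  ext j
  simpa [pad] using h j j.isLt

/-- The stack of a vector of length `m` with bits `f` on top of a vector with bits `g`. -/
def cat (m : ℕ) (f g : ℕ → ZMod 2) (p : ℕ) : ZMod 2 := if p < m then f p else g (p - m)

theorem cat_of_lt {m : ℕ} {f g : ℕ → ZMod 2} {p : ℕ} (h : p < m) : cat m f g p = f p := if_pos h

theorem cat_of_le {m : ℕ} {f g : ℕ → ZMod 2} {p : ℕ} (h : m ≤ p) : cat m f g p = g (p - m) :=
  if_neg (by omega)

theorem cat_sub (m : ℕ) (f g f' g' : ℕ → ZMod 2) :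
    cat m (f - f') (g - g') = cat m f g - cat m f' g' := by
  ext p
  simp only [cat, Pi.sub_apply]
  split_ifs <;> rfl

theorem getD_ofFn {m : ℕ} (x : Bits m) (p : ℕ) : (List.ofFn x).getD p 0 = pad x p := by
  by_cases h : p < m
  · simp [pad, h]
  · simp [pad, h]

theorem getD_append (l l' : List (ZMod 2)) :
    (fun p => (l ++ l').getD p 0) = cat l.length (fun p => l.getD p 0) fun p => l'.getD p 0 := by
  ext p
  by_cases h : p < l.length
  · rw [cat_of_lt h, List.getD_append _ _ _ _ h]
  · rw [cat_of_le (by omega), List.getD_append_right _ _ _ _ (by omega)]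

theorem getD_replicate (m p : ℕ) : (List.replicate m (0 : ZMod 2)).getD p 0 = 0 := by
  by_cases h : p < m <;> simp [h]

/-- The bits of a transmitted block vector, as a function of the codeword block and of the new and
the previous blocks of the streams. -/
def txVec (L : Lengths) (c : Bits L.lcm1) (x y : (a : Stream) → Bits (L.len a)) : ℕ → ZMod 2 :=
  cat L.lcm1 (pad c) <| cat (L.len .cm2) (pad (x .cm2)) <|
  cat (L.len .cn1) (pad (y .cn1)) <| cat (L.len .cn2) (pad (y .cn2)) <|
  cat (L.len .p1) (pad (x .p1)) <| cat L.l1u 0 <| cat (L.len .cn1) (pad (x .cn1)) <|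
  cat L.l1d 0 <| cat (L.len .cn3) (pad (y .cn3)) <| cat (L.len .p2) (pad (x .p2)) <|
  cat (L.len .cn2) (pad (x .cn2)) (pad (x .cn3))

/-- The bits of a block vector of the relay, as a function of the sums of the previous blocks. -/
def relayVec (L : Lengths) (s : (a : Stream) → Bits (L.len a)) : ℕ → ZMod 2 :=
  cat L.l2 0 <| cat (L.len .cn1) (pad (s .cn1)) <| cat (L.len .cn2) (pad (s .cn2)) <|
  cat L.l3 0 (pad (s .cn3))

theorem getD_txStack (L : Lengths) {B : ℕ} (c : Fin B → Bits L.lcm1)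
    (u : (a : Stream) → Fin B → Bits (L.len a)) (k p : ℕ) :
    (txStack L c u k).getD p 0 =
      txVec L (block c k) (fun a => block (u a) k) (fun a => block (u a) (k - 1)) p := by
  refine congrFun (a := p) (f := fun p => (txStack L c u k).getD p 0) ?_
  simp only [txStack, List.append_assoc, getD_append, getD_ofFn, getD_replicate, List.length_ofFn,
    List.length_replicate]
  rfl

theorem getD_relayStack (L : Lengths) {B : ℕ} (u : Fin 2 → (a : Stream) → Fin B → Bits (L.len a))
    (k p : ℕ) :
    (relayStack L u k).getD p 0 =
      relayVec L (fun a => block (u 0 a) (k - 1) + block (u 1 a) (k - 1)) p := by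
  refine congrFun (a := p) (f := fun p => (relayStack L u k).getD p 0) ?_
  simp only [relayStack, List.append_assoc, getD_append, getD_ofFn, getD_replicate,
    List.length_ofFn, List.length_replicate]
  rfl

theorem pad_sub' {m : ℕ} (x y : Bits m) : pad (x - y) = pad x - pad y := funext (pad_sub x y)

theorem cat_sub_zero (m : ℕ) (g g' : ℕ → ZMod 2) : cat m 0 (g - g') = cat m 0 g - cat m 0 g' := by
  rw [← cat_sub, sub_zero]

theorem txVec_sub (L : Lengths) (c c' : Bits L.lcm1) (x y x' y' : (a : Stream) → Bits (L.len a))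
    (p : ℕ) : txVec L (c - c') (x - x') (y - y') p = txVec L c x y p - txVec L c' x' y' p := by
  have h : ∀ (z z' : (a : Stream) → Bits (L.len a)) a, pad ((z - z') a) = pad (z a) - pad (z' a) :=
    fun z z' a => pad_sub' _ _
  refine congrFun (g := txVec L c x y - txVec L c' x' y') ?_ p
  unfold txVec
  simp only [h, pad_sub', cat_sub, cat_sub_zero]

theorem relayVec_sub (L : Lengths) (s s' : (a : Stream) → Bits (L.len a)) (p : ℕ) :
    relayVec L (s - s') p = relayVec L s p - relayVec L s' p := by
  have h : ∀ (z z' : (a : Stream) → Bits (L.len a)) a, pad ((z - z') a) = pad (z a) - pad (z' a) :=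
    fun z z' a => pad_sub' _ _
  refine congrFun (g := relayVec L s - relayVec L s') ?_ p
  unfold relayVec
  simp only [h, cat_sub, cat_sub_zero]

@[simp] theorem relayVec_zero (L : Lengths) (p : ℕ) : relayVec L 0 p = 0 := by
  simpa using relayVec_sub L 0 0 p

/-- The part of a received block vector that is above the noise level of the direct link. -/
def rxVec (P : Params) (T : ℕ) (L : Lengths) (c c' : Bits L.lcm1)
    (x y x' y' : (a : Stream) → Bits (L.len a)) (p : ℕ) : ZMod 2 :=
  txVec L c x y p
    + (if T * (P.nd - P.nc) ≤ p then txVec L c' x' y' (p - T * (P.nd - P.nc)) else 0)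
    + (if T * (P.nd - P.nr) ≤ p then relayVec L (y + y') (p - T * (P.nd - P.nr)) else 0)

/-- Linearity of the channel and of both block formats; this reduces unique decodability to a
statement about a kernel. -/
theorem rxVec_sub (P : Params) (T : ℕ) (L : Lengths) (c c' d d' : Bits L.lcm1)
    (x y x' y' z w z' w' : (a : Stream) → Bits (L.len a)) (p : ℕ) :
    rxVec P T L (c - d) (c' - d') (x - z) (y - w) (x' - z') (y' - w') p =
      rxVec P T L c c' x y x' y' p - rxVec P T L d d' z w z' w' p := by
  have h : y - w + (y' - w') = y + y' - (w + w') := by abel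
  simp only [rxVec, txVec_sub, h, relayVec_sub]
  split_ifs <;> ring

theorem downShift_mulVec (q : ℕ) (x : Bits q) (j : Fin q) :
    (downShift q *ᵥ x) j = if 1 ≤ (j : ℕ) then pad x (j - 1) else 0 := by
  simp only [downShift, Matrix.mulVec, dotProduct, Matrix.of_apply, ite_mul, one_mul, zero_mul]
  split_ifs with h
  · rw [Finset.sum_eq_single (⟨j - 1, by omega⟩ : Fin q)]
    · rw [if_pos (by simp; omega), pad_of_lt _ (by omega)]
    · intro b _ hb
      rw [if_neg]
      intro h'
      exact hb (Fin.ext (by simp; omega))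
    · simp
  · exact Finset.sum_eq_zero fun b _ => if_neg (by omega)

theorem downShift_pow_mulVec (q m : ℕ) (x : Bits q) (j : Fin q) :
    (downShift q ^ m *ᵥ x) j = if m ≤ (j : ℕ) then pad x (j - m) else 0 := by
  induction m generalizing j with
  | zero => simp [pad]
  | succ m ih =>
    rw [pow_succ', ← Matrix.mulVec_mulVec, downShift_mulVec]
    by_cases h1 : 1 ≤ (j : ℕ)
    · rw [if_pos h1, pad_of_lt _ (by omega : (j : ℕ) - 1 < q), ih]
      simp only
      by_cases h : m + 1 ≤ (j : ℕ)
      · rw [if_pos h, if_pos (by omega)]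
        congr 1
        omega
      · rw [if_neg h, if_neg (by omega)]
    · rw [if_neg h1, if_neg (by omega)]

theorem relayOutput_apply (P : Params) (x : Fin 2 → Bits P.q) (j : Fin P.q) {e : ℕ}
    (he : (j : ℕ) = P.q - P.ns + e) : P.relayOutput x j = pad (x 0) e + pad (x 1) e := by
  have h : P.q - P.ns ≤ (j : ℕ) := by omega
  have h' : (j : ℕ) - (P.q - P.ns) = e := by omega
  simp only [Params.relayOutput, Pi.add_apply, downShift_pow_mulVec, if_pos h, h']

/-- Counting levels from the top of the desired signal makes `q` disappear: the two weaker signals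
just start lower. -/
theorem rxOutput_apply (P : Params) (hc : P.nc ≤ P.nd) (hr : P.nr ≤ P.nd) (x : Fin 2 → Bits P.q)
    (xr : Bits P.q) (i : Fin 2) (j : Fin P.q) {e : ℕ} (he : (j : ℕ) = P.q - P.nd + e) :
    P.rxOutput x xr i j = pad (x i) e
      + (if P.nd - P.nc ≤ e then pad (x (1 - i)) (e - (P.nd - P.nc)) else 0)
      + (if P.nd - P.nr ≤ e then pad xr (e - (P.nd - P.nr)) else 0) := by
  have hq : P.nd ≤ P.q := by unfold Params.q; omega
  simp only [Params.rxOutput, Pi.add_apply, downShift_pow_mulVec]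
  congr 1
  · congr 1
    · rw [if_pos (by omega)]; congr 1; omega
    · by_cases h : P.nd - P.nc ≤ e
      · rw [if_pos h, if_pos (by omega)]; congr 1; omega
      · rw [if_neg h, if_neg (by omega)]
  · by_cases h : P.nd - P.nr ≤ e
    · rw [if_pos h, if_pos (by omega)]; congr 1; omega
    · rw [if_neg h, if_neg (by omega)]

theorem txVec_cn1 (L : Lengths) (c : Bits L.lcm1) (x y : (a : Stream) → Bits (L.len a)) {p j : ℕ}
    (hp : p = L.lcm1 + L.len .cm2 + L.len .cn1 + L.len .cn2 + L.len .p1 + L.l1u + j)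
    (hj : j < L.len .cn1) : txVec L c x y p = pad (x .cn1) j := by
  rw [txVec, cat_of_le (by omega), cat_of_le (by omega), cat_of_le (by omega),
    cat_of_le (by omega), cat_of_le (by omega), cat_of_le (by omega), cat_of_lt (by omega)]
  congr 1; omega

theorem txVec_cn2 (L : Lengths) (c : Bits L.lcm1) (x y : (a : Stream) → Bits (L.len a)) {p j : ℕ}
    (hp : p = L.lcm1 + L.len .cm2 + 2 * L.len .cn1 + L.len .cn2 + L.len .p1 + L.l1u + L.l1d
      + L.len .cn3 + L.len .p2 + j)
    (hj : j < L.len .cn2) : txVec L c x y p = pad (x .cn2) j := by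
  rw [txVec, cat_of_le (by omega), cat_of_le (by omega), cat_of_le (by omega),
    cat_of_le (by omega), cat_of_le (by omega), cat_of_le (by omega), cat_of_le (by omega),
    cat_of_le (by omega), cat_of_le (by omega), cat_of_le (by omega), cat_of_lt (by omega)]
  congr 1; omega

theorem txVec_cn3 (L : Lengths) (c : Bits L.lcm1) (x y : (a : Stream) → Bits (L.len a)) {p j : ℕ}
    (hp : p = L.lcm1 + L.len .cm2 + 2 * L.len .cn1 + 2 * L.len .cn2 + L.len .p1 + L.l1u + L.l1d
      + L.len .cn3 + L.len .p2 + j) : txVec L c x y p = pad (x .cn3) j := by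
  rw [txVec, cat_of_le (by omega), cat_of_le (by omega), cat_of_le (by omega),
    cat_of_le (by omega), cat_of_le (by omega), cat_of_le (by omega), cat_of_le (by omega),
    cat_of_le (by omega), cat_of_le (by omega), cat_of_le (by omega), cat_of_le (by omega)]
  congr 1; omega

/-! ### Linear schemes and the kernel condition for decoding -/

/-- The received block vectors of a receiver, whose own transmitter encodes the first common signal
with `E` while the other one uses `E'`, determine its message and the common signals of the
other user (a statement about the kernel of a linear map). -/
def DecodableAt (P : Params) (T : ℕ) (L : Lengths) {γ : ℕ} (E E' : Bits γ →+ Bits L.lcm1) : Prop :=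
  ∀ (B : ℕ) (v v' : ℕ → Bits γ) (u u' : ℕ → (a : Stream) → Bits (L.len a)),
    (∀ k ≤ B, ∀ p < T * P.nd,
      rxVec P T L (E (v (k + 1))) (E' (v' (k + 1))) (u (k + 1)) (u k) (u' (k + 1)) (u' k) p = 0) →
    ∀ k < B, v (k + 1) = 0 ∧ u (k + 1) = 0 ∧ v' (k + 1) = 0 ∧ u' (k + 1) .cm2 = 0

/-- A choice of block lengths and of linear encoders for the blocks of the first common signal for
which the relay and the receivers can decode what they need. -/
structure LinearScheme (P : Params) (T : ℕ) where
  L : Lengths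
  γ : ℕ
  E : Fin 2 → Bits γ →+ Bits L.lcm1
  T_pos : 0 < T
  nc_le : P.nc ≤ P.nd
  nr_le : P.nr ≤ P.nd
  valid : L.Valid P T
  relay_cn1 : L.len .cn1 = 0 ∨
    L.lcm1 + L.len .cm2 + 2 * L.len .cn1 + L.len .cn2 + L.len .p1 + L.l1u ≤ T * P.ns
  relay_cn2 : L.len .cn2 = 0 ∨
    L.lcm1 + L.len .cm2 + 2 * L.len .cn1 + 2 * L.len .cn2 + L.len .p1 + L.l1u + L.l1d
      + L.len .cn3 + L.len .p2 ≤ T * P.ns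
  relay_cn3 : L.len .cn3 = 0 ∨
    L.lcm1 + L.len .cm2 + 2 * L.len .cn1 + 2 * L.len .cn2 + L.len .p1 + L.l1u + L.l1d
      + 2 * L.len .cn3 + L.len .p2 ≤ T * P.ns
  decodable : ∀ i, DecodableAt P T L (E i) (E (1 - i))

/-- The number of bits that each user transmits per block. -/
def LinearScheme.rate {P : Params} {T : ℕ} (S : LinearScheme P T) : ℕ :=
  S.γ + S.L.len .cm2 + S.L.len .cn1 + S.L.len .cn2 + S.L.len .cn3 + S.L.len .p1 + S.L.len .p2

/-- Under interleaving, a shift by `a` levels in every channel use becomes a shift of the block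
vector by `T * a` bits. -/
theorem mul_le_mul_add_iff {T t : ℕ} (ht : t < T) (a e : ℕ) : T * a ≤ e * T + t ↔ a ≤ e := by
  constructor
  · intro h
    by_contra! h'
    nlinarith [Nat.mul_le_mul_left T (show e + 1 ≤ a by omega)]
  · intro h
    nlinarith [Nat.mul_le_mul_left T h]

theorem mul_add_sub_mul {T t a e : ℕ} (h : a ≤ e) : e * T + t - T * a = (e - a) * T + t := by
  obtain ⟨f, rfl⟩ := Nat.exists_eq_add_of_le h
  rw [Nat.add_sub_cancel_left, add_mul, mul_comm a T]
  omega

theorem block_zero {B m : ℕ} (u : Fin B → Bits m) : block u 0 = 0 := by simp [block]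

theorem block_map {B m n : ℕ} (E : Bits m →+ Bits n) (u : Fin B → Bits m) (k : ℕ) :
    block (fun b => E (u b)) k = E (block u k) := by
  unfold block
  split_ifs <;> simp

theorem block_injective {B m : ℕ} {u u' : Fin B → Bits m}
    (h : ∀ k < B, block u (k + 1) = block u' (k + 1)) : u = u' := by
  ext b : 1
  simpa [block, Nat.succ_le_of_lt b.isLt] using h b b.isLt

/-- The numbering of the messages that are encoded into the first common signal. -/
noncomputable def bitsEquiv (B γ : ℕ) : Fin (2 ^ (γ * B)) ≃ (Fin B → Bits γ) :=
  (Fintype.equivFinOfCardEq (by simp [pow_mul])).symm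

/-! ### Causality of the relay and injectivity at the receivers -/

namespace LinearScheme

variable {P : Params} {T : ℕ} (S : LinearScheme P T) {B : ℕ}

/-- The codebook of the first common signal. -/
noncomputable def book (B : ℕ) (i : Fin 2) (m : Fin (2 ^ (S.γ * B))) (b : Fin B) : Bits S.L.lcm1 :=
  S.E i (bitsEquiv B S.γ m b)

/-- The encoders. -/
noncomputable def enc (i : Fin 2) (w : Msg S.L B (2 ^ (S.γ * B))) (k : Fin ((B + 1) * T)) :
    Bits P.q :=
  fun j => (txStack S.L (S.book B i w.1) w.2 ((k : ℕ) / T + 1)).getD ((j : ℕ) * T + (k : ℕ) % T) 0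

/-- The relay output. -/
noncomputable def relayIn (w : Fin 2 → Msg S.L B (2 ^ (S.γ * B))) (k : Fin ((B + 1) * T)) :
    Bits P.q :=
  P.relayOutput fun i => S.enc i (w i) k

/-- The relay input, as a function of the messages. -/
noncomputable def relayTarget (w : Fin 2 → Msg S.L B (2 ^ (S.γ * B))) (k : ℕ) : Bits P.q :=
  fun j => (relayStack S.L (fun i => (w i).2) (k / T + 1)).getD ((j : ℕ) * T + k % T) 0

theorem pad_enc (i : Fin 2) (w : Msg S.L B (2 ^ (S.γ * B))) (k : Fin ((B + 1) * T)) {e : ℕ}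
    (he : e < P.q) : pad (S.enc i w k) e =
      txVec S.L (S.E i (block (bitsEquiv B S.γ w.1) (k / T + 1)))
        (fun a => block (w.2 a) (k / T + 1)) (fun a => block (w.2 a) (k / T)) (e * T + k % T) := by
  rw [pad_of_lt _ he, enc, getD_txStack, ← block_map]
  rfl

theorem pad_relayTarget (w : Fin 2 → Msg S.L B (2 ^ (S.γ * B))) (k : ℕ) {e : ℕ}
    (he : e < P.q) : pad (S.relayTarget w k) e =
      relayVec S.L (fun a => block ((w 0).2 a) (k / T) + block ((w 1).2 a) (k / T))
        (e * T + k % T) := by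
  rw [pad_of_lt _ he, relayTarget, getD_relayStack]
  rfl

theorem relayTarget_of_lt (w : Fin 2 → Msg S.L B (2 ^ (S.γ * B))) {k : ℕ} (hk : k < T) :
    S.relayTarget w k = 0 := by
  refine eq_zero_of_pad fun j hj => ?_
  rw [pad_relayTarget _ _ _ hj, Nat.div_eq_of_lt hk]
  simp only [block_zero, add_zero]
  exact relayVec_zero _ _

theorem relayIn_apply (w : Fin 2 → Msg S.L B (2 ^ (S.γ * B))) (k : Fin ((B + 1) * T)) {e : ℕ}
    (he : e < P.ns) : S.relayIn w k ⟨P.q - P.ns + e, by unfold Params.q; omega⟩ =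
      txVec S.L (S.E 0 (block (bitsEquiv B S.γ (w 0).1) (k / T + 1)))
        (fun a => block ((w 0).2 a) (k / T + 1)) (fun a => block ((w 0).2 a) (k / T))
        (e * T + k % T) +
      txVec S.L (S.E 1 (block (bitsEquiv B S.γ (w 1).1) (k / T + 1)))
        (fun a => block ((w 1).2 a) (k / T + 1)) (fun a => block ((w 1).2 a) (k / T))
        (e * T + k % T) := by
  have hq : e < P.q := by unfold Params.q; omega
  rw [relayIn, relayOutput_apply P _ _ rfl, pad_enc _ _ _ _ hq, pad_enc _ _ _ _ hq]

/-- What the relay has received determines the sums of the neutralization signals that lie above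
its noise level. -/
theorem sum_eq_of_relayIn_eq (w w' : Fin 2 → Msg S.L B (2 ^ (S.γ * B))) (k : Fin ((B + 1) * T))
    (h : ∀ j : Fin k, S.relayIn w ⟨j, j.isLt.trans k.isLt⟩ = S.relayIn w' ⟨j, j.isLt.trans k.isLt⟩)
    (hk : T ≤ k) (a : Stream) (f : ℕ) (hf : S.L.len a = 0 ∨ f + S.L.len a ≤ T * P.ns)
    (ha : ∀ c x y j, j < S.L.len a → txVec S.L c x y (f + j) = pad (x a) j) :
    block ((w 0).2 a) (k / T) + block ((w 1).2 a) (k / T) =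
      block ((w' 0).2 a) (k / T) + block ((w' 1).2 a) (k / T) := by
  rw [← sub_eq_zero]
  refine eq_zero_of_pad fun j hj => ?_
  have hT := S.T_pos
  have hb : 1 ≤ (k : ℕ) / T := (Nat.one_le_div_iff hT).2 hk
  have ht : (f + j) % T < T := Nat.mod_lt _ hT
  have he : (f + j) / T < P.ns := by
    rw [Nat.div_lt_iff_lt_mul hT, mul_comm]; omega
  -- The channel use of the preceding block in which bit `f + j` of the block vector was sent, at
  -- level `(f + j) / T`. It lies before `k`, so the relay knows its output.
  set n := ((k : ℕ) / T - 1) * T + (f + j) % T with hn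
  have hnk : n < k := by
    have h1 : ((k : ℕ) / T - 1) * T + T = (k : ℕ) / T * T := by
      rw [← Nat.succ_mul, Nat.succ_eq_add_one, Nat.sub_add_cancel hb]
    have := Nat.div_mul_le_self k T
    omega
  have hdiv : n / T + 1 = k / T := by
    rw [hn, mul_comm, Nat.mul_add_div hT, Nat.div_eq_of_lt ht]; omega
  have hmod : (f + j) / T * T + n % T = f + j := by
    rw [hn, mul_comm, mul_comm _ T, Nat.mul_add_mod, Nat.mod_mod, Nat.div_add_mod]
  have h2 := congrFun (h ⟨n, hnk⟩) ⟨P.q - P.ns + (f + j) / T, by unfold Params.q; omega⟩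
  rw [relayIn_apply _ _ _ he, relayIn_apply _ _ _ he] at h2
  simp only [hmod, ha _ _ _ _ hj, hdiv] at h2
  rw [pad_sub, pad_add, pad_add, h2, sub_self]

theorem relayTarget_eq_of_relayIn_eq (w w' : Fin 2 → Msg S.L B (2 ^ (S.γ * B)))
    (k : Fin ((B + 1) * T)) (h : ∀ j : Fin k,
      S.relayIn w ⟨j, j.isLt.trans k.isLt⟩ = S.relayIn w' ⟨j, j.isLt.trans k.isLt⟩) :
    S.relayTarget w k = S.relayTarget w' k := by
  rcases lt_or_ge (k : ℕ) T with hk | hk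
  · rw [relayTarget_of_lt _ _ hk, relayTarget_of_lt _ _ hk]
  have h1 := S.sum_eq_of_relayIn_eq w w' k h hk .cn1 _
    (S.relay_cn1.imp_right fun h => le_trans (by omega) h)
    fun c x y j hj => txVec_cn1 _ c x y rfl hj
  have h2 := S.sum_eq_of_relayIn_eq w w' k h hk .cn2 _
    (S.relay_cn2.imp_right fun h => le_trans (by omega) h)
    fun c x y j hj => txVec_cn2 _ c x y rfl hj
  have h3 := S.sum_eq_of_relayIn_eq w w' k h hk .cn3 _
    (S.relay_cn3.imp_right fun h => le_trans (by omega) h)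
    fun c x y j _ => txVec_cn3 _ c x y rfl
  unfold relayTarget relayStack
  simp only [Nat.add_sub_cancel, h1, h2, h3]

open Classical in
/-- The relaying function. -/
noncomputable def relayFun (k : Fin ((B + 1) * T)) (y : Fin (k : ℕ) → Bits P.q) : Bits P.q :=
  if h : ∃ w : Fin 2 → Msg S.L B (2 ^ (S.γ * B)),
    ∀ j : Fin k, S.relayIn w ⟨j, j.isLt.trans k.isLt⟩ = y j then S.relayTarget h.choose k else 0

/-- The message pair chosen by the relay need not be the true one: all pairs with the same past at
the relay lead to the same relay input. -/
theorem relayFun_relayIn (w : Fin 2 → Msg S.L B (2 ^ (S.γ * B))) (k : Fin ((B + 1) * T)) :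
    (S.relayFun k fun j => S.relayIn w ⟨j, j.isLt.trans k.isLt⟩) = S.relayTarget w k := by
  have h : ∃ w' : Fin 2 → Msg S.L B (2 ^ (S.γ * B)), ∀ j : Fin k,
    S.relayIn w' ⟨j, j.isLt.trans k.isLt⟩ = S.relayIn w ⟨j, j.isLt.trans k.isLt⟩ :=
    ⟨w, fun _ => rfl⟩
  rw [relayFun, dif_pos h]
  exact S.relayTarget_eq_of_relayIn_eq _ _ k h.choose_spec

/-- The received sequence, as a function of the messages. -/
noncomputable def rxSeq (w : Fin 2 → Msg S.L B (2 ^ (S.γ * B))) (i : Fin 2)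
    (k : Fin ((B + 1) * T)) : Bits P.q :=
  P.rxOutput (fun i => S.enc i (w i) k) (S.relayTarget w k) i

theorem rxSeq_apply (w : Fin 2 → Msg S.L B (2 ^ (S.γ * B))) (i : Fin 2) (k : Fin ((B + 1) * T))
    {e : ℕ} (he : e < P.nd) : S.rxSeq w i k ⟨P.q - P.nd + e, by unfold Params.q; omega⟩ =
      rxVec P T S.L (S.E i (block (bitsEquiv B S.γ (w i).1) (k / T + 1)))
        (S.E (1 - i) (block (bitsEquiv B S.γ (w (1 - i)).1) (k / T + 1)))
        (fun a => block ((w i).2 a) (k / T + 1)) (fun a => block ((w i).2 a) (k / T))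
        (fun a => block ((w (1 - i)).2 a) (k / T + 1)) (fun a => block ((w (1 - i)).2 a) (k / T))
        (e * T + k % T) := by
  have hq : P.nd ≤ P.q := by unfold Params.q; omega
  have hc := S.nc_le
  have hr := S.nr_le
  have ht : (k : ℕ) % T < T := Nat.mod_lt _ S.T_pos
  have hs : (fun a => block ((w 0).2 a) ((k : ℕ) / T) + block ((w 1).2 a) (k / T)) =
      (fun a => block ((w i).2 a) ((k : ℕ) / T)) + fun a => block ((w (1 - i)).2 a) (k / T) := by
    fin_cases i
    · rfl
    · exact funext fun a => add_comm _ _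
  rw [rxSeq, rxOutput_apply P hc hr _ _ _ _ rfl, rxVec, pad_enc _ _ _ _ (by omega)]
  congr 1
  · congr 1
    by_cases h : P.nd - P.nc ≤ e
    · rw [if_pos h, if_pos ((mul_le_mul_add_iff ht _ _).2 h), pad_enc _ _ _ _ (by omega),
        mul_add_sub_mul h]
    · rw [if_neg h, if_neg (mt (mul_le_mul_add_iff ht _ _).1 h)]
  · by_cases h : P.nd - P.nr ≤ e
    · rw [if_pos h, if_pos ((mul_le_mul_add_iff ht _ _).2 h), pad_relayTarget _ _ _ (by omega),
        mul_add_sub_mul h, hs]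
    · rw [if_neg h, if_neg (mt (mul_le_mul_add_iff ht _ _).1 h)]

/-- The difference of two message pairs with equal received sequences satisfies the hypothesis of
`DecodableAt`, because the encoders of `cm1` are additive. -/
theorem eq_of_rxSeq_eq (w w' : Fin 2 → Msg S.L B (2 ^ (S.γ * B))) (i : Fin 2)
    (h : S.rxSeq w i = S.rxSeq w' i) :
    w i = w' i ∧ (w (1 - i)).1 = (w' (1 - i)).1 ∧ (w (1 - i)).2 .cm2 = (w' (1 - i)).2 .cm2 := by
  have hT := S.T_pos
  have key := S.decodable i B
    (fun k => block (bitsEquiv B S.γ (w i).1) k - block (bitsEquiv B S.γ (w' i).1) k)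
    (fun k => block (bitsEquiv B S.γ (w (1 - i)).1) k - block (bitsEquiv B S.γ (w' (1 - i)).1) k)
    (fun k => (fun a => block ((w i).2 a) k) - fun a => block ((w' i).2 a) k)
    (fun k => (fun a => block ((w (1 - i)).2 a) k) - fun a => block ((w' (1 - i)).2 a) k) ?_
  · have hM : ∀ {m m' : Fin (2 ^ (S.γ * B))}, (∀ k < B, block (bitsEquiv B S.γ m) (k + 1) -
        block (bitsEquiv B S.γ m') (k + 1) = 0) → m = m' := fun hm =>
      (bitsEquiv B S.γ).injective (block_injective fun k hk => sub_eq_zero.1 (hm k hk))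
    refine ⟨Prod.ext (hM fun k hk => (key k hk).1) ?_, hM fun k hk => (key k hk).2.2.1, ?_⟩
    · ext a : 1
      exact block_injective fun k hk => sub_eq_zero.1 (congrFun (key k hk).2.1 a)
    · exact block_injective fun k hk => sub_eq_zero.1 (key k hk).2.2.2
  · intro k hk p hp
    have ht : p % T < T := Nat.mod_lt _ hT
    have he : p / T < P.nd := by rwa [Nat.div_lt_iff_lt_mul hT, mul_comm]
    have hn : k * T + p % T < (B + 1) * T := by
      have := Nat.mul_le_mul_right T (show k + 1 ≤ B + 1 by omega)
      rw [add_mul k] at this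
      omega
    have hdiv : (k * T + p % T) / T = k := by
      rw [mul_comm, Nat.mul_add_div hT, Nat.div_eq_of_lt ht, add_zero]
    have hmod : p / T * T + (k * T + p % T) % T = p := by
      rw [mul_comm k T, mul_comm _ T, Nat.mul_add_mod, Nat.mod_mod, Nat.div_add_mod]
    have h1 := congrFun (congrFun h ⟨_, hn⟩) ⟨P.q - P.nd + p / T, by unfold Params.q; omega⟩
    rw [rxSeq_apply _ _ _ _ he, rxSeq_apply _ _ _ _ he] at h1
    simp only [hdiv, hmod] at h1
    simp only [map_sub, rxVec_sub]
    rw [h1, sub_self]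

end LinearScheme

/-! ### The zero-error codes of a linear scheme -/

namespace LinearScheme

variable {P : Params} {T : ℕ} (S : LinearScheme P T)

instance (B : ℕ) : Nonempty (Msg S.L B (2 ^ (S.γ * B))) := ⟨⟨⟨0, by positivity⟩, 0⟩⟩

/-- A message pair that leads to the given received sequence. -/
noncomputable def decAll (B : ℕ) (i : Fin 2) :
    (Fin ((B + 1) * T) → Bits P.q) → Fin 2 → Msg S.L B (2 ^ (S.γ * B)) :=
  Function.invFun fun w => S.rxSeq w i

theorem rxSeq_decAll {B : ℕ} (w : Fin 2 → Msg S.L B (2 ^ (S.γ * B))) (i : Fin 2) :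
    S.rxSeq (S.decAll B i (S.rxSeq w i)) i = S.rxSeq w i :=
  Function.invFun_eq (f := fun w => S.rxSeq w i) ⟨w, rfl⟩

/-- The code of a linear scheme. -/
noncomputable def code (B : ℕ) : Code P ((B + 1) * T) fun _ => Msg S.L B (2 ^ (S.γ * B)) where
  enc := S.enc
  relay := S.relayFun
  relay_first k hk y := by
    rw [relayFun]
    split_ifs
    · exact S.relayTarget_of_lt _ (by rw [hk]; exact S.T_pos)
    · rfl
  dec i y := S.decAll B i y i

theorem code_relayRx {B : ℕ} (w : Fin 2 → Msg S.L B (2 ^ (S.γ * B))) (k : Fin ((B + 1) * T)) :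
    (S.code B).relayRx w k = S.relayIn w k :=
  rfl

theorem code_relayTx {B : ℕ} (w : Fin 2 → Msg S.L B (2 ^ (S.γ * B))) (k : Fin ((B + 1) * T)) :
    (S.code B).relayTx w k = S.relayTarget w k := by
  rw [Code.relayTx]
  simp only [code_relayRx]
  exact S.relayFun_relayIn w k

theorem code_rx {B : ℕ} (w : Fin 2 → Msg S.L B (2 ^ (S.γ * B))) (i : Fin 2) :
    (S.code B).rx w i = S.rxSeq w i := by
  ext k : 1
  simp only [Code.rx, code_relayTx]
  rfl

/-- The WI-3 code of a linear scheme. -/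
noncomputable def wi3Code (B : ℕ) : WI3Code P T S.L B (2 ^ (S.γ * B)) where
  book := S.book B
  code := S.code B
  enc_eq _ _ _ _ := rfl
  relay_eq w k j := by rw [code_relayTx]; rfl
  decCommon i y := ((S.decAll B i y (1 - i)).1, (S.decAll B i y (1 - i)).2 .cm2)

theorem code_dec_rx {B : ℕ} (w : Fin 2 → Msg S.L B (2 ^ (S.γ * B))) (i : Fin 2) :
    (S.code B).dec i ((S.code B).rx w i) = w i := by
  rw [code_rx]
  exact (S.eq_of_rxSeq_eq _ _ i (S.rxSeq_decAll w i)).1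

theorem wi3Code_errorProb (B : ℕ) : (S.wi3Code B).errorProb = 0 := by
  have h : {w : Fin 2 → Msg S.L B (2 ^ (S.γ * B)) | ∃ i,
      (S.wi3Code B).code.dec i ((S.wi3Code B).code.rx w i) ≠ w i ∨
      (S.wi3Code B).decCommon i ((S.wi3Code B).code.rx w i) ≠
        ((w (1 - i)).1, (w (1 - i)).2 .cm2)} = ∅ := by
    refine Set.eq_empty_of_forall_notMem fun w => ?_
    rintro ⟨i, hi | hi⟩
    · exact hi (S.code_dec_rx w i)
    · refine hi ?_
      change (S.wi3Code B).decCommon i ((S.code B).rx w i) = _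
      rw [code_rx]
      exact Prod.ext (S.eq_of_rxSeq_eq _ _ i (S.rxSeq_decAll w i)).2.1
        (S.eq_of_rxSeq_eq _ _ i (S.rxSeq_decAll w i)).2.2
  rw [WI3Code.errorProb, h]
  simp

theorem card_msg (B : ℕ) : Nat.card (Msg S.L B (2 ^ (S.γ * B))) = 2 ^ (B * S.rate) := by
  let _ : Fintype Stream := ⟨⟨{.cm2, .cn1, .cn2, .cn3, .p1, .p2}, by simp⟩, fun a => by
    cases a <;> simp⟩
  have h : ∀ f : Stream → ℕ, ∏ a, f a = f .cm2 * f .cn1 * f .cn2 * f .cn3 * f .p1 * f .p2 := by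
    intro f
    change Multiset.prod (Multiset.map f {.cm2, .cn1, .cn2, .cn3, .p1, .p2}) = _
    simp [mul_assoc]
  rw [Msg, Nat.card_prod, Nat.card_pi, h]
  simp only [Nat.card_pi, Nat.card_fin, Nat.card_zmod, Finset.prod_const, Finset.card_univ,
    Fintype.card_fin, ← pow_mul, ← pow_add, rate]
  congr 1
  ring

/-- The factor `B / (B + 1)` is the price of the closing block, which only repeats neutralization
bits. -/
theorem wi3SumRate_eq (B : ℕ) : wi3SumRate T S.L B (2 ^ (S.γ * B)) =
    2 * S.rate / T * ((B : ℝ) / (B + 1)) := by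
  have hT : (T : ℝ) ≠ 0 := by exact_mod_cast S.T_pos.ne'
  have hB : (B : ℝ) + 1 ≠ 0 := by positivity
  rw [wi3SumRate, Nat.card_pi]
  simp only [card_msg, Finset.prod_const, Finset.card_univ, Fintype.card_fin, ← pow_mul]
  push_cast
  rw [← Real.rpow_natCast, Real.logb_rpow (by norm_num) (by norm_num)]
  push_cast
  field_simp

theorem wi3Achieves : P.WI3Achieves (2 * S.rate / T) := by
  refine ⟨T, S.T_pos, S.L, S.valid, fun B => 2 ^ (S.γ * B), S.wi3Code, fun B => by positivity,
    ?_, ?_⟩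
  · simp only [wi3SumRate_eq]
    simpa using (tendsto_natCast_div_add_atTop (1 : ℝ)).const_mul (2 * (S.rate : ℝ) / T)
  · simp only [wi3Code_errorProb]
    exact tendsto_const_nhds

end LinearScheme

/-! ### From block codes to codes of every length -/

namespace Code

variable {P : Params} {m n : ℕ} {W W' : Fin 2 → Type}

/-- A code of length `m`, used for messages that form a smaller set and continued by zeros. -/
def extend (C : Code P m W) (h : m ≤ n) (f : ∀ i, W' i → W i) (g : ∀ i, W i → W' i) :
    Code P n W' where
  enc i w k := if hk : (k : ℕ) < m then C.enc i (f i w) ⟨k, hk⟩ else 0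
  relay k y := if hk : (k : ℕ) < m then C.relay ⟨k, hk⟩ y else 0
  relay_first k hk y := by
    split_ifs with h'
    · exact C.relay_first ⟨k, h'⟩ hk y
    · rfl
  dec i y := g i (C.dec i fun k => y (Fin.castLE h k))

/-- By causality of the relay, what is appended after channel use `m` does not affect the first `m`
outputs. -/
theorem extend_rx (C : Code P m W) (h : m ≤ n) (f : ∀ i, W' i → W i) (g : ∀ i, W i → W' i)
    (w : ∀ i, W' i) (i : Fin 2) (k : Fin m) :
    (C.extend h f g).rx w i (Fin.castLE h k) = C.rx (fun i => f i (w i)) i k := by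
  have henc : ∀ (j : ℕ) (hj : j < m) (hj' : j < n) i,
      (C.extend h f g).enc i (w i) ⟨j, hj'⟩ = C.enc i (f i (w i)) ⟨j, hj⟩ :=
    fun j hj _ i => dif_pos hj
  have hrel : (C.extend h f g).relayTx w (Fin.castLE h k) =
      C.relayTx (fun i => f i (w i)) k := by
    simp only [relayTx, extend, Fin.val_castLE, k.isLt, dif_pos]
    congr 1
    ext j : 1
    simp only [relayRx]
    congr 1
    ext i : 1
    exact dif_pos (j.isLt.trans k.isLt)
  simp only [rx, hrel]
  congr 1
  ext i : 1
  exact dif_pos k.isLt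

theorem errorProb_eq_zero (C : Code P n W) (h : ∀ w i, C.dec i (C.rx w i) = w i) :
    C.errorProb = 0 := by
  have : {w : (i : Fin 2) → W i | ∃ i, C.dec i (C.rx w i) ≠ w i} = ∅ :=
    Set.eq_empty_of_forall_notMem fun w ⟨i, hi⟩ => hi (h w i)
  rw [errorProb, this, Set.ncard_empty, Nat.cast_zero, zero_div]

theorem exists_errorProb_eq_zero (C : Code P m W) (hC : ∀ w i, C.dec i (C.rx w i) = w i)
    (h : m ≤ n) (K : Fin 2 → ℕ) (hK : ∀ i, 0 < K i) (hW : ∀ i, K i ≤ Nat.card (W i)) : ∃ C' : Code P n fun i => Fin (K i), C'.errorProb = 0 := by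
  have hfin : ∀ i, Finite (W i) := fun i =>
    Nat.finite_of_card_ne_zero ((hK i).trans_le (hW i)).ne'
  have hf : ∀ i, ∃ f : Fin (K i) → W i, Function.Injective f := fun i =>
    ⟨fun x => (Finite.equivFin (W i)).symm (Fin.castLE (hW i) x),
      (Equiv.injective _).comp (Fin.castLE_injective _)⟩
  choose f hf using hf
  have : ∀ i, Nonempty (Fin (K i)) := fun i => ⟨⟨0, hK i⟩⟩
  refine ⟨C.extend h f fun i => Function.invFun (f i), errorProb_eq_zero _ fun w i => ?_⟩
  change Function.invFun (f i) (C.dec i fun k => _) = w i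
  simp only [extend_rx]
  rw [hC (fun i => f i (w i)) i, Function.leftInverse_invFun (hf i)]

end Code

instance (P : Params) (n : ℕ) (W : Fin 2 → Type) [∀ i, Nonempty (W i)] : Nonempty (Code P n W) :=
  ⟨⟨fun _ _ _ => 0, fun _ _ => 0, fun _ _ _ => rfl, fun _ _ => Classical.arbitrary _⟩⟩

theorem LinearScheme.sumRateAchievable {P : Params} {T : ℕ} (S : LinearScheme P T) :
    P.SumRateAchievable (2 * S.rate / T) := by
  intro ε hε
  have hT : (0 : ℝ) < T := by exact_mod_cast S.T_pos
  -- Each user gives up half of `ε`; the maximum keeps the rate non-negative.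
  set ρ : ℝ := max 0 (S.rate / T - ε / 2) with hρ
  refine ⟨fun _ => ρ, ⟨fun _ => le_max_left _ _, ?_⟩, ?_⟩
  swap
  · have : (S.rate : ℝ) / T - ε / 2 ≤ ρ := le_max_right _ _
    rw [mul_div_assoc]
    linarith
  have hpos : ∀ n : ℕ, 0 < ⌊(2 : ℝ) ^ ((n : ℝ) * ρ)⌋₊ := fun n => by
    rw [Nat.floor_pos]
    exact Real.one_le_rpow (by norm_num) (by positivity)
  -- Rounding `n` down to whole blocks and the closing block cost at most two blocks, that is `2 *
  -- S.rate` bits. The slack `n * ε / 2` covers this from `n = 4 * S.rate / ε` on.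
  have hex : ∀ n : ℕ, ∃ C : Code P n fun _ => Fin ⌊(2 : ℝ) ^ ((n : ℝ) * ρ)⌋₊,
      4 * S.rate / ε ≤ n → T ≤ n → C.errorProb = 0 := by
    intro n
    have : Nonempty (Fin ⌊(2 : ℝ) ^ ((n : ℝ) * ρ)⌋₊) := ⟨⟨0, hpos n⟩⟩
    by_cases h : 4 * S.rate / ε ≤ n ∧ T ≤ n
    swap
    · exact ⟨Classical.arbitrary _, fun h1 h2 => (h ⟨h1, h2⟩).elim⟩
    have h1 : 1 ≤ n / T := (Nat.one_le_div_iff S.T_pos).2 h.2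
    obtain ⟨C, hC⟩ := (S.code (n / T - 1)).exists_errorProb_eq_zero (n := n)
      (fun w i => S.code_dec_rx w i) (by
        rw [Nat.sub_add_cancel h1]; exact Nat.div_mul_le_self n T)
      (fun _ => ⌊(2 : ℝ) ^ ((n : ℝ) * ρ)⌋₊) (fun _ => hpos n) (fun _ => by
        rw [S.card_msg]
        refine Nat.floor_le_of_le ?_
        push_cast
        rw [← Real.rpow_natCast]
        refine Real.rpow_le_rpow_of_exponent_le (by norm_num) ?_
        push_cast [Nat.cast_sub h1]
        have h3 : (n : ℝ) ≤ ((n / T : ℕ) + 1) * T := by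
          exact_mod_cast (Nat.lt_mul_of_div_lt (Nat.lt_succ_self _) S.T_pos).le
        have h4 : (1 : ℝ) ≤ (n / T : ℕ) := by exact_mod_cast h1
        rcases max_cases 0 ((S.rate : ℝ) / T - ε / 2) with h5 | h5
        · rw [hρ, h5.1, mul_zero]
          exact mul_nonneg (by linarith) (by positivity)
        · rw [hρ, h5.1]
          have h6 : (n : ℝ) / T ≤ (n / T : ℕ) + 1 := by rwa [div_le_iff₀ hT]
          have h7 := mul_le_mul_of_nonneg_right h6 (Nat.cast_nonneg (α := ℝ) S.rate)
          have h8 := (div_le_iff₀ hε).1 h.1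
          have h9 : (n : ℝ) * (S.rate / T - ε / 2) = n / T * S.rate - n * ε / 2 := by ring
          rw [h9]
          nlinarith)
    exact ⟨C, fun _ _ => hC⟩
  choose C hC using hex
  refine ⟨C, tendsto_const_nhds.congr' ?_⟩
  filter_upwards [eventually_ge_atTop T, (tendsto_natCast_atTop_atTop (R := ℝ)).eventually_ge_atTop
    (4 * S.rate / ε)] with n h1 h2
  exact (hC n h2 h1).symm

/-! ### Positions of the streams in the block vectors -/

section Segments

variable (L : Lengths) (c : Bits L.lcm1) (x y s : (a : Stream) → Bits (L.len a)) {p j : ℕ}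

theorem txVec_cm1 (hj : j < L.lcm1) : txVec L c x y j = pad c j := cat_of_lt hj

theorem txVec_cn1_old (hp : p = L.lcm1 + L.len .cm2 + j) (hj : j < L.len .cn1) :
    txVec L c x y p = pad (y .cn1) j := by
  rw [txVec, cat_of_le (by omega), cat_of_le (by omega), cat_of_lt (by omega)]
  congr 1; omega

theorem txVec_cn2_old (hp : p = L.lcm1 + L.len .cm2 + L.len .cn1 + j) (hj : j < L.len .cn2) :
    txVec L c x y p = pad (y .cn2) j := by
  rw [txVec, cat_of_le (by omega), cat_of_le (by omega), cat_of_le (by omega),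
    cat_of_lt (by omega)]
  congr 1; omega

theorem txVec_p1 (hp : p = L.lcm1 + L.len .cm2 + L.len .cn1 + L.len .cn2 + j)
    (hj : j < L.len .p1) : txVec L c x y p = pad (x .p1) j := by
  rw [txVec, cat_of_le (by omega), cat_of_le (by omega), cat_of_le (by omega),
    cat_of_le (by omega), cat_of_lt (by omega)]
  congr 1; omega

theorem txVec_l1u (hp : p = L.lcm1 + L.len .cm2 + L.len .cn1 + L.len .cn2 + L.len .p1 + j)
    (hj : j < L.l1u) : txVec L c x y p = 0 := by
  rw [txVec, cat_of_le (by omega), cat_of_le (by omega), cat_of_le (by omega),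
    cat_of_le (by omega), cat_of_le (by omega), cat_of_lt (by omega)]
  rfl

theorem txVec_cn3_old (hp : p = L.lcm1 + L.len .cm2 + 2 * L.len .cn1 + L.len .cn2 + L.len .p1
      + L.l1u + L.l1d + j)
    (hj : j < L.len .cn3) : txVec L c x y p = pad (y .cn3) j := by
  rw [txVec, cat_of_le (by omega), cat_of_le (by omega), cat_of_le (by omega),
    cat_of_le (by omega), cat_of_le (by omega), cat_of_le (by omega), cat_of_le (by omega),
    cat_of_le (by omega), cat_of_lt (by omega)]
  congr 1; omega

theorem txVec_p2 (hp : p = L.lcm1 + L.len .cm2 + 2 * L.len .cn1 + L.len .cn2 + L.len .p1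
      + L.l1u + L.l1d + L.len .cn3 + j)
    (hj : j < L.len .p2) : txVec L c x y p = pad (x .p2) j := by
  rw [txVec, cat_of_le (by omega), cat_of_le (by omega), cat_of_le (by omega),
    cat_of_le (by omega), cat_of_le (by omega), cat_of_le (by omega), cat_of_le (by omega),
    cat_of_le (by omega), cat_of_le (by omega), cat_of_lt (by omega)]
  congr 1; omega

theorem relayVec_l2 (hj : j < L.l2) : relayVec L s j = 0 := cat_of_lt hj

theorem relayVec_cn1 (hp : p = L.l2 + j) (hj : j < L.len .cn1) :
    relayVec L s p = pad (s .cn1) j := by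
  rw [relayVec, cat_of_le (by omega), cat_of_lt (by omega)]
  congr 1; omega

theorem relayVec_cn2 (hp : p = L.l2 + L.len .cn1 + j) (hj : j < L.len .cn2) :
    relayVec L s p = pad (s .cn2) j := by
  rw [relayVec, cat_of_le (by omega), cat_of_le (by omega), cat_of_lt (by omega)]
  congr 1; omega

theorem relayVec_l3 (hp : p = L.l2 + L.len .cn1 + L.len .cn2 + j) (hj : j < L.l3) :
    relayVec L s p = 0 := by
  rw [relayVec, cat_of_le (by omega), cat_of_le (by omega), cat_of_le (by omega),
    cat_of_lt (by omega)]
  rfl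

theorem relayVec_cn3 (hp : p = L.l2 + L.len .cn1 + L.len .cn2 + L.l3 + j) :
    relayVec L s p = pad (s .cn3) j := by
  rw [relayVec, cat_of_le (by omega), cat_of_le (by omega), cat_of_le (by omega),
    cat_of_le (by omega)]
  congr 1; omega

end Segments

theorem eq_zero_of_len {m : ℕ} (h : m = 0) (x : Bits m) : x = 0 :=
  eq_zero_of_pad fun j hj => by omega

theorem relayVec_of_len (L : Lengths) (s : (a : Stream) → Bits (L.len a)) (h1 : L.len .cn1 = 0)
    (h2 : L.len .cn2 = 0) (h3 : L.len .cn3 = 0) (p : ℕ) : relayVec L s p = 0 := by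
  unfold relayVec
  rw [eq_zero_of_len h1 (s .cn1), eq_zero_of_len h2 (s .cn2), eq_zero_of_len h3 (s .cn3)]
  have h : ∀ m, pad (0 : Bits m) = 0 := fun m => funext pad_zero
  simp only [h]
  have h' : ∀ m, cat m 0 0 = 0 := fun m => by simpa using cat_sub_zero m 0 0
  simp only [h', Pi.zero_apply]

/-! ### The neutralization of streams below uncoded common bits -/

/-- The lengths make `cm1`, the repetitions and `p1` fill exactly the top A = 2(n_d - n_c) bits, and
put new `cn2` bits and the interferer's `p1` and new bits below the noise level. Only the top `γ`
bits of `cm1` carry information: at the other receiver they meet the zeros and new `cn1` bits, and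
the rest of `cm1` leaves `p2` undisturbed. -/
theorem decodableAt_of_cn1 (P : Params) (hc : P.nc < P.nd) (hr : P.nr ≤ P.nd) (L : Lengths)
    {γ : ℕ} (E E' : Bits γ →+ Bits L.lcm1) (hE : ∀ v j, pad (E v) j = pad v j)
    (hE' : ∀ v j, pad (E' v) j = pad v j)
    (hcm2 : L.len .cm2 = 0) (hcn3 : L.len .cn3 = 0) (hl1d : L.l1d = 0) (hl3 : L.l3 = 0)
    (hcm1 : L.lcm1 + L.len .cn1 + L.len .cn2 = min (2 * (P.nd - P.nc)) (2 * P.nc))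
    (hp1 : L.len .p1 = 2 * (P.nd - P.nc) - 2 * P.nc)
    (hl1u : L.l1u = 2 * P.nc - 2 * (P.nd - P.nc))
    (hp2 : L.len .p2 + L.len .cn1 = min (2 * (P.nd - P.nc)) (2 * P.nc))
    (hγ : γ = L.l1u + L.len .cn1) (hγ' : γ ≤ L.lcm1)
    (hl2 : (L.len .cn1 = 0 ∧ L.len .cn2 = 0) ∨ L.l2 + 2 * P.nc = 2 * P.nr + L.lcm1) :
    DecodableAt P 2 L E E' := by
  intro B v v' u u' h
  -- The leading zeros of the relay end exactly where the interferer's `cm1` ends.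
  have hrel : ∀ s p, p < 2 * (P.nd - P.nc) + L.lcm1 → 2 * (P.nd - P.nr) ≤ p →
      relayVec L s (p - 2 * (P.nd - P.nr)) = 0 := by
    intro s p hp hp'
    rcases hl2 with h0 | h0
    · exact relayVec_of_len L s h0.1 h0.2 hcn3 _
    · exact relayVec_l2 L s (by omega)
  have hX : ∀ k ≤ B, ∀ p < 2 * (P.nd - P.nc),
      txVec L (E (v (k + 1))) (u (k + 1)) (u k) p = 0 := by
    intro k hk p hp
    have := h k hk p (by omega)
    rw [rxVec, if_neg (by omega), add_zero] at this
    split_ifs at this with h1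
    · rwa [hrel _ _ (by omega) h1, add_zero] at this
    · rwa [add_zero] at this
  have hv : ∀ k ≤ B, v (k + 1) = 0 := fun k hk => eq_zero_of_pad fun j hj => by
    rw [← hE, ← hX k hk j (by omega), txVec_cm1 _ _ _ _ (by omega)]
  have hcn1 : ∀ k ≤ B, u k .cn1 = 0 := fun k hk => eq_zero_of_pad fun j hj => by
    rw [← hX k hk (L.lcm1 + L.len .cm2 + j) (by omega), txVec_cn1_old _ _ _ _ rfl hj]
  have hcn2 : ∀ k ≤ B, u k .cn2 = 0 := fun k hk => eq_zero_of_pad fun j hj => by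
    rw [← hX k hk (L.lcm1 + L.len .cm2 + L.len .cn1 + j) (by omega),
      txVec_cn2_old _ _ _ _ rfl hj]
  have hpp1 : ∀ k ≤ B, u (k + 1) .p1 = 0 := fun k hk => eq_zero_of_pad fun j hj => by
    rw [← hX k hk (L.lcm1 + L.len .cm2 + L.len .cn1 + L.len .cn2 + j) (by omega),
      txVec_p1 _ _ _ _ rfl hj]
  -- Backward decoding: the new `cn1` bits in block `k + 1` are known from their repetition in block
  -- `k + 2`, hence `k < B`.
  have hv' : ∀ k < B, v' (k + 1) = 0 := fun k hk => eq_zero_of_pad fun j hj => by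
    have h1 := h k hk.le (2 * (P.nd - P.nc) + j) (by omega)
    have h2 : txVec L (E (v (k + 1))) (u (k + 1)) (u k) (2 * (P.nd - P.nc) + j) = 0 := by
      rcases lt_or_ge j L.l1u with hj' | hj'
      · exact txVec_l1u _ _ _ _ (j := j) (by omega) hj'
      · rw [txVec_cn1 _ _ _ _ (j := j - L.l1u) (by omega) (by omega), hcn1 _ (by omega), pad_zero]
    rw [rxVec, h2, if_pos (by omega), Nat.add_sub_cancel_left, txVec_cm1 _ _ _ _ (by omega), hE',
      zero_add] at h1
    split_ifs at h1 with h3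
    · rwa [hrel _ _ (by omega) h3, add_zero] at h1
    · rwa [add_zero] at h1
  have hpp2 : ∀ k < B, u (k + 1) .p2 = 0 := fun k hk => eq_zero_of_pad fun j hj => by
    have h1 := h k hk.le (2 * (P.nd - P.nc) + (γ + j)) (by omega)
    rw [rxVec, txVec_p2 _ _ _ _ (j := j) (by omega) hj, if_pos (by omega),
      Nat.add_sub_cancel_left] at h1
    rcases lt_or_ge (γ + j) L.lcm1 with h2 | h2
    · rw [txVec_cm1 _ _ _ _ h2, hv' k hk, map_zero, pad_zero, add_zero] at h1
      split_ifs at h1 with h3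
      · rwa [hrel _ _ (by omega) h3, add_zero] at h1
      · rwa [add_zero] at h1
    rcases lt_or_ge (γ + j) (L.lcm1 + L.len .cn1) with h3 | h3
    -- Neutralization: the own summand in the relay signal is known to vanish, and the other summand
    -- cancels the interferer's repetition in characteristic 2.
    · rw [txVec_cn1_old _ _ _ _ (j := γ + j - L.lcm1) (by omega) (by omega), if_pos (by omega),
        relayVec_cn1 _ _ (j := γ + j - L.lcm1) (by omega) (by omega), Pi.add_apply, pad_add,
        hcn1 k hk.le, pad_zero, zero_add, add_assoc, CharTwo.add_self_eq_zero, add_zero] at h1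
      exact h1
    rcases lt_or_ge (γ + j) (L.lcm1 + L.len .cn1 + L.len .cn2) with h4 | h4
    · rw [txVec_cn2_old _ _ _ _ (j := γ + j - L.lcm1 - L.len .cn1) (by omega) (by omega),
        if_pos (by omega), relayVec_cn2 _ _ (j := γ + j - L.lcm1 - L.len .cn1) (by omega)
        (by omega), Pi.add_apply, pad_add, hcn2 k hk.le, pad_zero, zero_add, add_assoc,
        CharTwo.add_self_eq_zero, add_zero] at h1
      exact h1
    rw [txVec_l1u _ _ _ _ (j := γ + j - (L.lcm1 + L.len .cn1 + L.len .cn2)) (by omega)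
      (by omega), add_zero] at h1
    have h5 : ∀ s, 2 * (P.nd - P.nr) ≤ 2 * (P.nd - P.nc) + (γ + j) →
        relayVec L s (2 * (P.nd - P.nc) + (γ + j) - 2 * (P.nd - P.nr)) = 0 := by
      intro s h6
      rcases hl2 with h0 | h0
      · exact relayVec_of_len L s h0.1 h0.2 hcn3 _
      · rw [relayVec_cn3 _ _ (j := γ + j - (L.lcm1 + L.len .cn1 + L.len .cn2)) (by omega),
          pad_of_le _ (by omega)]
    split_ifs at h1 with h6
    · rwa [h5 _ h6, add_zero] at h1
    · rwa [add_zero] at h1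
  intro k hk
  refine ⟨hv k hk.le, ?_, hv' k hk, eq_zero_of_len hcm2 _⟩
  ext a : 1
  cases a with
  | cm2 => exact eq_zero_of_len hcm2 _
  | cn1 => exact hcn1 _ (by omega)
  | cn2 => exact hcn2 _ (by omega)
  | cn3 => exact eq_zero_of_len hcn3 _
  | p1 => exact hpp1 _ (by omega)
  | p2 => exact hpp2 _ (by omega)

/-! ### Coded common bits and one stream for neutralization -/

/-- Either receiver sees one zero-padded and one repeated codeword, displaced by A = 2(n_d - n_c) ≤
γ. A bit of the repeated word that is disturbed in one copy is clean in the other; once this word is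
removed, the padded one can be read off. -/
theorem decodableAt_of_coded (P : Params) (hc : P.nc < P.nd) (hr : P.nr ≤ P.nd) (L : Lengths)
    {γ : ℕ} (E E' : Bits γ →+ Bits L.lcm1)
    (hE : (∀ v j, pad (E v) j = pad v j) ∧
        (∀ v j, pad (E' v) j = if j < γ then pad v j else pad v (j - γ)) ∨
      (∀ v j, pad (E' v) j = pad v j) ∧
        (∀ v j, pad (E v) j = if j < γ then pad v j else pad v (j - γ)))
    (hcm2 : L.len .cm2 = 0) (hcn1 : L.len .cn1 = 0) (hcn3 : L.len .cn3 = 0)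
    (hp1 : L.len .p1 = 0) (hl1u : L.l1u = 0) (hl1d : L.l1d = 0)
    (hcm1 : L.lcm1 = 2 * γ) (hcn2 : L.lcm1 + L.len .cn2 = 2 * P.nc)
    (hp2 : L.len .p2 = 2 * (P.nd - P.nc)) (hγ : 2 * (P.nd - P.nc) ≤ γ)
    (hl2 : L.len .cn2 = 0 ∨ L.l2 + L.len .cn2 = 2 * P.nr) :
    DecodableAt P 2 L E E' := by
  intro B v v' u u' h
  have hrel : ∀ s p, p < 2 * (P.nd - P.nc) + L.lcm1 → 2 * (P.nd - P.nr) ≤ p →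
      relayVec L s (p - 2 * (P.nd - P.nr)) = 0 := by
    intro s p hp hp'
    rcases hl2 with h0 | h0
    · exact relayVec_of_len L s hcn1 h0 hcn3 _
    · exact relayVec_l2 L s (by omega)
  have hlow : ∀ k ≤ B, ∀ p < L.lcm1, p < 2 * (P.nd - P.nc) → pad (E (v (k + 1))) p = 0 := by
    intro k hk p hp hp'
    have := h k hk p (by omega)
    rw [rxVec, txVec_cm1 _ _ _ _ hp, if_neg (by omega), add_zero] at this
    split_ifs at this with h1
    · rwa [hrel _ _ (by omega) h1, add_zero] at this
    · rwa [add_zero] at this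
  have hhigh : ∀ k ≤ B, ∀ j < L.lcm1,
      txVec L (E (v (k + 1))) (u (k + 1)) (u k) (2 * (P.nd - P.nc) + j) +
        pad (E' (v' (k + 1))) j = 0 := by
    intro k hk j hj
    have := h k hk (2 * (P.nd - P.nc) + j) (by omega)
    rw [rxVec, if_pos (by omega), Nat.add_sub_cancel_left, txVec_cm1 _ _ _ _ hj] at this
    split_ifs at this with h1
    · rwa [hrel _ _ (by omega) h1, add_zero] at this
    · rwa [add_zero] at this
  have hhigh' : ∀ k ≤ B, ∀ j, 2 * (P.nd - P.nc) + j < L.lcm1 →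
      pad (E (v (k + 1))) (2 * (P.nd - P.nc) + j) + pad (E' (v' (k + 1))) j = 0 := by
    intro k hk j hj
    rw [← hhigh k hk j (by omega), txVec_cm1 _ _ _ _ hj]
  have hvv : ∀ k ≤ B, v (k + 1) = 0 ∧ v' (k + 1) = 0 := by
    intro k hk
    rcases hE with ⟨hE, hE'⟩ | ⟨hE', hE⟩
    · have h0 : v' (k + 1) = 0 := eq_zero_of_pad fun j hj => by
        rcases lt_or_ge j (γ - 2 * (P.nd - P.nc)) with h1 | h1
        · have := hhigh' k hk (γ + j) (by omega)
          rwa [hE, hE', pad_of_le _ (by omega), if_neg (by omega), Nat.add_sub_cancel_left,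
            zero_add] at this
        · have := hhigh' k hk j (by omega)
          rwa [hE, hE', pad_of_le _ (by omega), if_pos (by omega), zero_add] at this
      refine ⟨eq_zero_of_pad fun j hj => ?_, h0⟩
      rcases lt_or_ge j (2 * (P.nd - P.nc)) with h1 | h1
      · rw [← hE, hlow k hk j (by omega) h1]
      · have := hhigh' k hk (j - 2 * (P.nd - P.nc)) (by omega)
        rwa [h0, map_zero, pad_zero, add_zero, Nat.add_sub_cancel' h1, hE] at this
    · have h0 : v (k + 1) = 0 := eq_zero_of_pad fun j hj => by
        rcases lt_or_ge j (2 * (P.nd - P.nc)) with h1 | h1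
        · have := hlow k hk j (by omega) h1
          rwa [hE, if_pos hj] at this
        · have := hhigh' k hk (γ + (j - 2 * (P.nd - P.nc))) (by omega)
          rw [hE, hE', if_neg (by omega), pad_of_le (v' _) (by omega), add_zero] at this
          rw [← this]
          congr 1
          omega
      refine ⟨h0, eq_zero_of_pad fun j hj => ?_⟩
      have := hhigh' k hk j (by omega)
      rwa [h0, map_zero, pad_zero, zero_add, hE'] at this
  -- Successive decoding from the top: where the relay is active, neutralization leaves the own bit
  -- at `p` plus the own bit A places higher, which is already known.
  have hX : ∀ k ≤ B, ∀ p < 2 * P.nd, txVec L (E (v (k + 1))) (u (k + 1)) (u k) p = 0 := by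
    intro k hk p
    induction p using Nat.strong_induction_on with
    | _ p ih =>
      intro hp
      rcases lt_or_ge p L.lcm1 with h1 | h1
      · rw [txVec_cm1 _ _ _ _ h1, (hvv k hk).1, map_zero, pad_zero]
      rcases lt_or_ge p (2 * (P.nd - P.nc) + L.lcm1) with h2 | h2
      · have := hhigh k hk (p - 2 * (P.nd - P.nc)) (by omega)
        rwa [(hvv k hk).2, map_zero, pad_zero, add_zero, Nat.add_sub_cancel' (by omega)] at this
      have h3 := ih (p - 2 * (P.nd - P.nc)) (by omega) (by omega)
      rw [txVec_cn2_old _ _ _ _ (j := p - 2 * (P.nd - P.nc) - L.lcm1) (by omega) (by omega)] at h3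
      have h4 := h k hk p hp
      rwa [rxVec, if_pos (by omega), if_pos (by omega),
        txVec_cn2_old _ _ _ _ (p := p - 2 * (P.nd - P.nc)) (j := p - 2 * (P.nd - P.nc) - L.lcm1)
          (by omega) (by omega),
        relayVec_cn2 _ _ (j := p - 2 * (P.nd - P.nc) - L.lcm1) (by omega) (by omega),
        Pi.add_apply, pad_add, h3, zero_add, add_assoc, CharTwo.add_self_eq_zero, add_zero] at h4
  intro k hk
  refine ⟨(hvv k hk.le).1, ?_, (hvv k hk.le).2, eq_zero_of_len hcm2 _⟩
  ext a : 1
  cases a with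
  | cm2 => exact eq_zero_of_len hcm2 _
  | cn1 => exact eq_zero_of_len hcn1 _
  | cn2 =>
    refine eq_zero_of_pad fun j hj => ?_
    rw [← hX (k + 1) (by omega) (L.lcm1 + L.len .cm2 + L.len .cn1 + j) (by omega),
      txVec_cn2_old _ _ _ _ rfl hj]
  | cn3 => exact eq_zero_of_len hcn3 _
  | p1 => exact eq_zero_of_len hp1 _
  | p2 =>
    refine eq_zero_of_pad fun j hj => ?_
    rw [← hX k hk.le (L.lcm1 + L.len .cm2 + 2 * L.len .cn1 + L.len .cn2 + L.len .p1 + L.l1u + L.l1d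
      + L.len .cn3 + j) (by omega), txVec_p2 _ _ _ _ rfl hj]

/-! ### Uncoded common bits between two neutralization streams -/

/-- The gaps `l1u` and `l3` both have the length of `cm1`: the interfering `cm1` falls into the own
gap, and the interferer's gap coincides with the silence of the relay between `cn2` and `cn3`. Hence
the residue of neutralization at `p` is always an own bit A = 2(n_d - n_c) places higher, and
decoding from the top succeeds. -/
theorem decodableAt_of_cn3 (P : Params) (hc : P.nc < P.nd) (hr : P.nr ≤ P.nd) (L : Lengths)
    {γ : ℕ} (E E' : Bits γ →+ Bits L.lcm1) (hE : ∀ v j, pad (E v) j = pad v j)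
    (hE' : ∀ v j, pad (E' v) j = pad v j)
    (hcm2 : L.len .cm2 = 0) (hcn1 : L.len .cn1 = 0) (hp1 : L.len .p1 = 0) (hl1d : L.l1d = 0)
    (hcm1 : L.lcm1 = γ) (hl1u : L.l1u = γ) (hl3 : L.l3 = γ)
    (hcn2 : L.lcm1 + L.len .cn2 = 2 * (P.nd - P.nc))
    (hcn3 : 2 * (P.nd - P.nc) + γ + L.len .cn3 = 2 * P.nc)
    (hp2 : L.len .p2 = 2 * (P.nd - P.nc)) (hl2 : L.l2 + 2 * P.nc = 2 * P.nr + L.lcm1) :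
    DecodableAt P 2 L E E' := by
  intro B v v' u u' h
  have hrel : ∀ s p, p < 2 * (P.nd - P.nc) + L.lcm1 → 2 * (P.nd - P.nr) ≤ p →
      relayVec L s (p - 2 * (P.nd - P.nr)) = 0 :=
    fun s p hp hp' => relayVec_l2 L s (by omega)
  have hX : ∀ k ≤ B, ∀ p < 2 * P.nd, txVec L (E (v (k + 1))) (u (k + 1)) (u k) p = 0 := by
    intro k hk p
    induction p using Nat.strong_induction_on with
    | _ p ih =>
      intro hp
      have h4 := h k hk p hp
      rcases lt_or_ge p (2 * (P.nd - P.nc)) with h1 | h1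
      · rw [rxVec, if_neg (by omega), add_zero] at h4
        split_ifs at h4 with h5
        · rwa [hrel _ _ (by omega) h5, add_zero] at h4
        · rwa [add_zero] at h4
      rcases lt_or_ge p (2 * (P.nd - P.nc) + γ) with h2 | h2
      · exact txVec_l1u _ _ _ _ (j := p - 2 * (P.nd - P.nc)) (by omega) (by omega)
      have h3 := ih (p - 2 * (P.nd - P.nc)) (by omega) (by omega)
      rw [rxVec, if_pos (by omega), if_pos (by omega)] at h4
      rcases lt_or_ge p (2 * (P.nd - P.nc) + 2 * (P.nd - P.nc)) with h5 | h5
      · rw [txVec_cn2_old _ _ _ _ (j := p - 2 * (P.nd - P.nc) - γ) (by omega) (by omega)] at h3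
        rwa [txVec_cn2_old _ _ _ _ (p := p - 2 * (P.nd - P.nc)) (j := p - 2 * (P.nd - P.nc) - γ)
            (by omega) (by omega),
          relayVec_cn2 _ _ (j := p - 2 * (P.nd - P.nc) - γ) (by omega) (by omega),
          Pi.add_apply, pad_add, h3, zero_add, add_assoc, CharTwo.add_self_eq_zero,
          add_zero] at h4
      rcases lt_or_ge p (2 * (P.nd - P.nc) + (2 * (P.nd - P.nc) + γ)) with h6 | h6
      · rwa [txVec_l1u _ _ _ _ (p := p - 2 * (P.nd - P.nc))
            (j := p - 2 * (P.nd - P.nc) - 2 * (P.nd - P.nc)) (by omega) (by omega),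
          relayVec_l3 _ _ (j := p - 2 * (P.nd - P.nc) - 2 * (P.nd - P.nc)) (by omega) (by omega),
          add_zero, add_zero] at h4
      · rw [txVec_cn3_old _ _ _ _ (j := p - 2 * (P.nd - P.nc) - (2 * (P.nd - P.nc) + γ))
          (by omega) (by omega)] at h3
        rwa [txVec_cn3_old _ _ _ _ (p := p - 2 * (P.nd - P.nc))
            (j := p - 2 * (P.nd - P.nc) - (2 * (P.nd - P.nc) + γ)) (by omega) (by omega),
          relayVec_cn3 _ _ (j := p - 2 * (P.nd - P.nc) - (2 * (P.nd - P.nc) + γ)) (by omega),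
          Pi.add_apply, pad_add, h3, zero_add, add_assoc, CharTwo.add_self_eq_zero,
          add_zero] at h4
  have hv' : ∀ k ≤ B, v' (k + 1) = 0 := fun k hk => eq_zero_of_pad fun j hj => by
    have h1 := h k hk (2 * (P.nd - P.nc) + j) (by omega)
    rw [rxVec, hX k hk _ (by omega), if_pos (by omega), Nat.add_sub_cancel_left,
      txVec_cm1 _ _ _ _ (by omega), hE', zero_add] at h1
    split_ifs at h1 with h3
    · rwa [hrel _ _ (by omega) h3, add_zero] at h1
    · rwa [add_zero] at h1
  intro k hk
  refine ⟨eq_zero_of_pad fun j hj => ?_, ?_, hv' k hk.le, eq_zero_of_len hcm2 _⟩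
  · rw [← hE, ← hX k hk.le j (by omega), txVec_cm1 _ _ _ _ (by omega)]
  ext a : 1
  cases a with
  | cm2 => exact eq_zero_of_len hcm2 _
  | cn1 => exact eq_zero_of_len hcn1 _
  | cn2 =>
    refine eq_zero_of_pad fun j hj => ?_
    rw [← hX (k + 1) (by omega) (L.lcm1 + L.len .cm2 + L.len .cn1 + j) (by omega),
      txVec_cn2_old _ _ _ _ rfl hj]
  | cn3 =>
    refine eq_zero_of_pad fun j hj => ?_
    rw [← hX (k + 1) (by omega) (L.lcm1 + L.len .cm2 + 2 * L.len .cn1 + L.len .cn2 + L.len .p1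
      + L.l1u + L.l1d + j) (by omega), txVec_cn3_old _ _ _ _ rfl hj]
  | p1 => exact eq_zero_of_len hp1 _
  | p2 =>
    refine eq_zero_of_pad fun j hj => ?_
    rw [← hX k hk.le (L.lcm1 + L.len .cm2 + 2 * L.len .cn1 + L.len .cn2 + L.len .p1 + L.l1u + L.l1d
      + L.len .cn3 + j) (by omega), txVec_p2 _ _ _ _ rfl hj]

/-! ### Encoders and block lengths of the three designs -/

/-- The encoder that fills up its input with zeros. -/
def zeroPad (m n : ℕ) : Bits m →+ Bits n where
  toFun v j := pad v j
  map_zero' := by ext; simp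
  map_add' v w := by ext; simp [pad_add]

/-- The encoder that sends its input twice. -/
def repeatTwice (m n : ℕ) : Bits m →+ Bits n where
  toFun v j := if (j : ℕ) < m then pad v j else pad v (j - m)
  map_zero' := by ext; simp
  map_add' v w := by ext; simp only [pad_add, Pi.add_apply]; split_ifs <;> rfl

theorem pad_zeroPad {m n : ℕ} (h : m ≤ n) (v : Bits m) (j : ℕ) :
    pad (zeroPad m n v) j = pad v j := by
  by_cases hj : j < n
  · rw [pad_of_lt _ hj]; rfl
  · rw [pad_of_le _ (by omega), pad_of_le _ (by omega)]

theorem pad_repeatTwice {m n : ℕ} (h : n = 2 * m) (v : Bits m) (j : ℕ) :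
    pad (repeatTwice m n v) j = if j < m then pad v j else pad v (j - m) := by
  by_cases hj : j < n
  · rw [pad_of_lt _ hj]; rfl
  · rw [pad_of_le _ (by omega), if_neg (by omega), pad_of_le _ (by omega)]

/-- The lengths of the neutralization and private streams. -/
def streamLen (n1 n2 n3 p1 p2 : ℕ) : Stream → ℕ
  | .cm2 => 0
  | .cn1 => n1
  | .cn2 => n2
  | .cn3 => n3
  | .p1 => p1
  | .p2 => p2

/-- `h1` says `γ ≤ lcm1`; `h2` and `h3` put the new `cn1` and `cn2` bits above the noise level of
the relay; `h4` makes room for the aligning zeros `l2`. -/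
theorem exists_scheme_cn1 (P : Params) (hc : P.nc < P.nd) (hr : P.nr ≤ P.nd) (n1 n2 : ℕ)
    (h1 : 2 * P.nc - 2 * (P.nd - P.nc) + 2 * n1 + n2 ≤ min (2 * (P.nd - P.nc)) (2 * P.nc))
    (h2 : n1 = 0 ∨ max (2 * (P.nd - P.nc)) (2 * P.nc) + n1 ≤ 2 * P.ns)
    (h3 : n2 = 0 ∨ 2 * P.nd + n2 ≤ 2 * P.ns)
    (h4 : n1 + n2 = 0 ∨ n1 + n2 + (2 * P.nc - 2 * (P.nd - P.nc)) ≤ 2 * P.nr) :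
    ∃ S : LinearScheme P 2, S.rate = max (2 * (P.nd - P.nc)) (2 * P.nc) + n1 + n2 := by
  have hq : P.nd ≤ P.q := by unfold Params.q; omega
  have hq' : P.ns ≤ P.q := by unfold Params.q; omega
  set A := 2 * (P.nd - P.nc) with hA
  set lcm1 := min A (2 * P.nc) - (n1 + n2) with hlcm1
  set γ := 2 * P.nc - A + n1 with hγ
  have hγl : γ ≤ lcm1 := by omega
  let L : Lengths := ⟨streamLen n1 n2 0 (A - 2 * P.nc) (min A (2 * P.nc) - n1), lcm1,
    2 * P.nc - A, 0, if n1 + n2 = 0 then 0 else 2 * P.nr + lcm1 - 2 * P.nc, 0⟩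
  refine ⟨⟨L, γ, fun _ => zeroPad γ lcm1, by omega, hc.le, hr, ⟨?_, ?_, Or.inl ⟨rfl, rfl⟩⟩,
    ?_, ?_, Or.inl rfl, fun _ => decodableAt_of_cn1 P hc hr L _ _ (pad_zeroPad hγl)
      (pad_zeroPad hγl) rfl rfl rfl rfl ?_ rfl rfl ?_ (add_comm _ _ |>.trans ?_) ?_ ?_⟩, ?_⟩
  all_goals simp only [L, streamLen, LinearScheme.rate]
  all_goals first | omega | (split_ifs <;> omega)

theorem exists_scheme_coded (P : Params) (hc : P.nc < P.nd) (hr : P.nr ≤ P.nd) (m η : ℕ)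
    (h1 : 2 * m + η = 2 * P.nc) (h2 : 2 * (P.nd - P.nc) ≤ m)
    (h3 : η = 0 ∨ 2 * P.nd + η ≤ 2 * P.ns) (h4 : η ≤ 2 * P.nr) :
    ∃ S : LinearScheme P 2, S.rate = 2 * (P.nd - P.nc) + m + η := by
  have hq : P.nd ≤ P.q := by unfold Params.q; omega
  have hq' : P.ns ≤ P.q := by unfold Params.q; omega
  have hml : m ≤ 2 * m := by omega
  let L : Lengths := ⟨streamLen 0 η 0 0 (2 * (P.nd - P.nc)), 2 * m, 0, 0, 2 * P.nr - η, 0⟩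
  refine ⟨⟨L, m, fun i => if i = 0 then zeroPad m (2 * m) else repeatTwice m (2 * m), by omega,
    hc.le, hr, ⟨?_, ?_, Or.inl ⟨rfl, rfl⟩⟩,
    Or.inl rfl, ?_, Or.inl rfl, fun i => decodableAt_of_coded P hc hr L _ _ ?_ rfl rfl rfl rfl
      rfl rfl rfl ?_ rfl h2 ?_⟩, ?_⟩
  case refine_4 =>
    fin_cases i
    · exact Or.inl ⟨pad_zeroPad hml, pad_repeatTwice rfl⟩
    · exact Or.inr ⟨pad_zeroPad hml, pad_repeatTwice rfl⟩
  all_goals simp only [L, streamLen, LinearScheme.rate]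
  all_goals omega

/-- Here `ν` is the total number of `cn2` and `cn3` bits, and `γ = 2 * nc - ν`. The strict
inequality `h1` makes `cn3` non-empty, as the second variant of the scheme demands; `h2` says that
`cn2` has non-negative length. -/
theorem exists_scheme_cn3 (P : Params) (hc : P.nc < P.nd) (hr : P.nr ≤ P.nd) (ν : ℕ)
    (h1 : 2 * (P.nd - P.nc) < ν) (h2 : 2 * P.nc ≤ 2 * (P.nd - P.nc) + ν) (h3 : ν ≤ 2 * P.nc)
    (h4 : ν ≤ 2 * P.nr) (h5 : 2 * P.nd + 2 * ν ≤ 2 * P.ns + 2 * P.nc) :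
    ∃ S : LinearScheme P 2, S.rate = 2 * (P.nd - P.nc) + ν := by
  have hq' : P.ns ≤ P.q := by unfold Params.q; omega
  set A := 2 * (P.nd - P.nc) with hA
  set γ := 2 * P.nc - ν with hγ
  let L : Lengths := ⟨streamLen 0 (A - γ) (ν - A) 0 A, γ, γ, 0, 2 * P.nr + γ - 2 * P.nc, γ⟩
  refine ⟨⟨L, γ, fun _ => zeroPad γ γ, by omega, hc.le, hr, ⟨?_, ?_, Or.inr ⟨?_, rfl, rfl⟩⟩,
    Or.inl rfl, ?_, ?_, fun _ => decodableAt_of_cn3 P hc hr L _ _ (pad_zeroPad le_rfl)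
      (pad_zeroPad le_rfl) rfl rfl rfl rfl rfl rfl rfl ?_ ?_ rfl ?_⟩, ?_⟩
  all_goals simp only [L, streamLen, LinearScheme.rate]
  all_goals omega

/-! ### The choice of the design in each regime -/

theorem exists_scheme_regimeA (P : Params) (h : P.RegimeA) : ∃ S : LinearScheme P 2,
    (S.rate : ℤ) = min ((P.ns : ℤ) + P.nd - P.nc)
      (min (2 * P.nd + P.nr - P.nc) (2 * max (P.nc : ℤ) (P.nr + P.nd - P.nc))) := by
  obtain ⟨h1, h2, h3⟩ := h
  obtain ⟨R, hR⟩ : ∃ x, x = min (P.ns + P.nd - P.nc)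
      (min (2 * P.nd + P.nr - P.nc) (2 * max P.nc (P.nr + P.nd - P.nc))) := ⟨_, rfl⟩
  suffices h : ∃ S : LinearScheme P 2, S.rate = R by
    obtain ⟨S, hS⟩ := h
    exact ⟨S, by rw [hS]; omega⟩
  have hrd : P.nr ≤ P.nd := by omega
  by_cases hA : P.nc ≤ P.nr + P.nd - P.nc ∧
    (P.nc ≤ 2 * (P.nd - P.nc) ∨ 2 * P.nc ≤ P.ns + P.nd - P.nc)
  · rw [max_eq_right hA.1] at hR
    by_cases hB : R ≤ 4 * (P.nd - P.nc) ∨ P.nc ≤ P.nd - P.nc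
    · obtain ⟨N, hN⟩ : ∃ x, x = R - max (2 * (P.nd - P.nc)) (2 * P.nc) := ⟨_, rfl⟩
      -- As much `cn2` as the relay can hear: a `cn1` bit counts twice in `h1` of
      -- `exists_scheme_cn1`, a `cn2` bit only once.
      obtain ⟨n2, hn2⟩ : ∃ x, x = min N (2 * P.ns - 2 * P.nd) := ⟨_, rfl⟩
      obtain ⟨S, hS⟩ := exists_scheme_cn1 P h2 hrd (N - n2) n2 (by omega) (by omega) (by omega)
        (by omega)
      exact ⟨S, by omega⟩
    · obtain ⟨S, hS⟩ := exists_scheme_cn3 P h2 hrd (R - 2 * (P.nd - P.nc)) (by omega) (by omega)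
        (by omega) (by omega) (by omega)
      exact ⟨S, by omega⟩
  · by_cases hB : P.nc ≤ 2 * (P.nd - P.nc)
    · obtain ⟨S, hS⟩ := exists_scheme_cn1 P h2 hrd 0 0 (by omega) (by omega) (by omega) (by omega)
      exact ⟨S, by omega⟩
    -- The rate will be `2 * nd - nc + η`; the three caps on `η` turn it into `2 * nd + nr - nc`,
    -- `ns + nd - nc` and `2 * nc`.
    · obtain ⟨η, hη⟩ : ∃ x, x = min (min P.nr (P.ns - P.nd)) (P.nc - 2 * (P.nd - P.nc)) := ⟨_, rfl⟩
      obtain ⟨S, hS⟩ := exists_scheme_coded P h2 hrd (P.nc - η) (2 * η) (by omega) (by omega)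
        (by omega) (by omega)
      exact ⟨S, by omega⟩

/-- As `ns ≤ nd`, the relay hears nothing below the noise level of the direct link, so only `cn1`
can be neutralized. If the cross link is too strong for that design, the minimum is `2 * nd - nc`,
which coding alone reaches. -/
theorem exists_scheme_regimeB (P : Params) (hc : P.nc < P.nd) (h : P.RegimeB) :
    ∃ S : LinearScheme P 2, (S.rate : ℤ) = min (2 * (P.nd : ℤ) - P.nc)
      (min (2 * max (P.ns : ℤ) (P.nd - P.nc)) (2 * max (P.nc : ℤ) (P.nr + P.nd - P.nc))) := by
  obtain ⟨h1, h2, h3⟩ := h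
  obtain ⟨R, hR⟩ : ∃ x, x = min (2 * P.nd - P.nc)
      (min (2 * max P.ns (P.nd - P.nc)) (2 * max P.nc (P.nr + P.nd - P.nc))) := ⟨_, rfl⟩
  suffices h : ∃ S : LinearScheme P 2, S.rate = R by
    obtain ⟨S, hS⟩ := h
    exact ⟨S, by rw [hS]; omega⟩
  have hrd : P.nr ≤ P.nd := by omega
  by_cases hA : P.nc ≤ 2 * (P.nd - P.nc)
  · obtain ⟨S, hS⟩ := exists_scheme_cn1 P hc hrd (R - max (2 * (P.nd - P.nc)) (2 * P.nc)) 0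
      (by omega) (by omega) (by omega) (by omega)
    exact ⟨S, by omega⟩
  · obtain ⟨S, hS⟩ := exists_scheme_coded P hc hrd P.nc 0 (by omega) (by omega) (by omega)
      (by omega)
    exact ⟨S, by omega⟩

theorem exists_scheme_regimeC (P : Params) (hc : P.nc < P.nd) (h : P.RegimeC) :
    ∃ S : LinearScheme P 2, (S.rate : ℤ) = min (2 * (P.nd : ℤ) - P.nc)
      (2 * max ((P.nr : ℤ) + P.ns - P.nc) (P.nd - P.nc)) := by
  obtain ⟨h1, h2, h3, h4⟩ := h
  have h5 : 2 * P.nd < 2 * P.ns + P.nc := by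
    have : (2 * P.nd : ℝ) < 2 * P.ns + P.nc := by linarith
    exact_mod_cast this
  -- The second term of the minimum is inactive: it is at least `2 * ns`, which exceeds `2 * nd -
  -- nc`.
  suffices h : ∃ S : LinearScheme P 2, S.rate = 2 * P.nd - P.nc by
    obtain ⟨S, hS⟩ := h
    exact ⟨S, by rw [hS]; omega⟩
  have hrd : P.nr ≤ P.nd := by omega
  by_cases hA : P.nc ≤ 2 * (P.nd - P.nc)
  · obtain ⟨S, hS⟩ := exists_scheme_cn1 P hc hrd
      (2 * P.nd - P.nc - max (2 * (P.nd - P.nc)) (2 * P.nc)) 0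
      (by omega) (by omega) (by omega) (by omega)
    exact ⟨S, by omega⟩
  · obtain ⟨S, hS⟩ := exists_scheme_coded P hc hrd P.nc 0 (by omega) (by omega) (by omega)
      (by omega)
    exact ⟨S, by omega⟩

/-! ### Comparison with the capacity expression and the outer bounds -/

theorem LinearScheme.wi3Attains {P : Params} (S : LinearScheme P 2) {R : ℝ} (hS : (S.rate : ℝ) = R)
    (ho : R = P.outerBound) (hcap : P.nc < P.ns → R = P.capacityExpr) : P.WI3Attains R := by
  have h : 2 * (S.rate : ℝ) / ((2 : ℕ) : ℝ) = R := by
    rw [← hS]; push_cast; ring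
  exact ⟨h ▸ S.wi3Achieves, h ▸ S.sumRateAchievable, ho, hcap⟩

/-- Moves the real identities to ℤ, where subtraction is not truncated and `omega` applies. -/
theorem exists_int_cast_eq (n : ℕ) : ∃ z : ℤ, (n : ℝ) = z ∧ z = n := ⟨n, by simp, rfl⟩

theorem wi3Attains_regimeA (P : Params) (h : P.RegimeA) : P.WI3Attains
    (min ((P.ns : ℝ) + P.nd - P.nc)
      (min (2 * (P.nd : ℝ) + P.nr - P.nc)
        (2 * max (P.nc : ℝ) ((P.nr : ℝ) + P.nd - P.nc)))) := by
  obtain ⟨S, hS⟩ := exists_scheme_regimeA P h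
  have hS' := congrArg (Int.cast : ℤ → ℝ) hS
  push_cast at hS'
  obtain ⟨h1, h2, h3⟩ := h
  obtain ⟨d, hd, hd'⟩ := exists_int_cast_eq P.nd
  obtain ⟨c, hc', hc''⟩ := exists_int_cast_eq P.nc
  obtain ⟨r, hr, hr'⟩ := exists_int_cast_eq P.nr
  obtain ⟨s, hs, hs'⟩ := exists_int_cast_eq P.ns
  -- The maxima decided by the regime are resolved first, which keeps the later case splits small.
  have e1 : max d c = d := by omega
  have e2 : max d r = d := by omega
  have e3 : max (d - c) 0 = d - c := by omega
  have e4 : max (s - c) 0 = s - c := by omega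
  have e5 : max c s = s := by omega
  have e6 : max d s = s := by omega
  have e7 : max (s - d) 0 = s - d := by omega
  have e8 : max c r = c := by omega
  have e9 : max c (d - s) = c := by omega
  refine S.wi3Attains hS' ?_ fun h4 => ?_
  · rw [Params.outerBound, if_pos ⟨h1, h2.le⟩]
    simp only [hd, hc', hr, hs]
    norm_cast
    simp only [e1, e2, e4, e5, e6, e7, e8, e9]
    clear hS hS' e1 e2 e3 e4 e5 e6 e7 e8 e9
    apply le_antisymm <;> simp only [le_min_iff, min_le_iff] <;> and_intros <;> omega
  · rw [Params.capacityExpr]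
    simp only [hd, hc', hr, hs]
    norm_cast
    simp only [e1, e2, e3, e6, e7]
    clear hS hS' e1 e2 e3 e4 e5 e6 e7 e8 e9
    apply le_antisymm <;> simp only [le_min_iff, min_le_iff] <;> and_intros <;> omega

theorem wi3Attains_regimeB (P : Params) (hc : P.nc < P.nd) (h : P.RegimeB) : P.WI3Attains
    (min (2 * (P.nd : ℝ) - P.nc)
      (min (2 * max (P.ns : ℝ) ((P.nd : ℝ) - P.nc))
        (2 * max (P.nc : ℝ) ((P.nr : ℝ) + P.nd - P.nc)))) := by
  obtain ⟨S, hS⟩ := exists_scheme_regimeB P hc h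
  have hS' := congrArg (Int.cast : ℤ → ℝ) hS
  push_cast at hS'
  obtain ⟨h1, h2, h3⟩ := h
  obtain ⟨d, hd, hd'⟩ := exists_int_cast_eq P.nd
  obtain ⟨c, hc', hc''⟩ := exists_int_cast_eq P.nc
  obtain ⟨r, hr, hr'⟩ := exists_int_cast_eq P.nr
  obtain ⟨s, hs, hs'⟩ := exists_int_cast_eq P.ns
  have e1 : max d c = d := by omega
  have e2 : max d r = d := by omega
  have e3 : max (d - c) 0 = d - c := by omega
  have e4 : max (s - c) 0 = s - c := by omega
  have e5 : max c s = s := by omega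
  have e6 : max d s = d := by omega
  have e7 : max (s - d) 0 = 0 := by omega
  have e8 : max c r = c := by omega
  have e9 : max c 0 = c := by omega
  refine S.wi3Attains hS' ?_ fun h4 => ?_
  · rw [Params.outerBound, if_pos ⟨h1, hc.le⟩]
    simp only [hd, hc', hr, hs]
    norm_cast
    simp only [e1, e2, e4, e5, e6, e7, e8]
    clear hS hS' e1 e2 e3 e4 e5 e6 e7 e8 e9
    apply le_antisymm <;> simp only [le_min_iff, min_le_iff] <;> and_intros <;> omega
  · rw [Params.capacityExpr]
    simp only [hd, hc', hr, hs]
    norm_cast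
    simp only [e1, e2, e3, e6, e7, e9, sub_zero]
    clear hS hS' e1 e2 e3 e4 e5 e6 e7 e8 e9
    apply le_antisymm <;> simp only [le_min_iff, min_le_iff] <;> and_intros <;> omega

theorem wi3Attains_regimeC (P : Params) (hc : P.nc < P.nd) (h : P.RegimeC) : P.WI3Attains
    (min (2 * (P.nd : ℝ) - P.nc)
      (2 * max ((P.nr : ℝ) + P.ns - P.nc) ((P.nd : ℝ) - P.nc))) := by
  obtain ⟨S, hS⟩ := exists_scheme_regimeC P hc h
  have hS' := congrArg (Int.cast : ℤ → ℝ) hS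
  push_cast at hS'
  obtain ⟨h1, h2, h3, h5⟩ := h
  have h6 : 2 * P.nd < 2 * P.ns + P.nc := by
    have : (2 * P.nd : ℝ) < 2 * P.ns + P.nc := by linarith
    exact_mod_cast this
  obtain ⟨d, hd, hd'⟩ := exists_int_cast_eq P.nd
  obtain ⟨c, hc', hc''⟩ := exists_int_cast_eq P.nc
  obtain ⟨r, hr, hr'⟩ := exists_int_cast_eq P.nr
  obtain ⟨s, hs, hs'⟩ := exists_int_cast_eq P.ns
  have e1 : max d c = d := by omega
  have e2 : max d r = d := by omega
  have e3 : max (d - c) 0 = d - c := by omega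
  have e4 : max (s - c) 0 = s - c := by omega
  have e5 : max c s = s := by omega
  have e6 : max d s = d := by omega
  have e7 : max (s - d) 0 = 0 := by omega
  have e8 : max c r = r := by omega
  have e9 : max c 0 = c := by omega
  refine S.wi3Attains hS' ?_ fun h4 => ?_
  · rw [Params.outerBound]
    simp only [hd, hc', hr, hs]
    split_ifs
    all_goals norm_cast
    all_goals simp only [e1, e2, e4, e5, e6, e7, e8]
    all_goals clear hS hS' e1 e2 e3 e4 e5 e6 e7 e8 e9
    all_goals
      apply le_antisymm <;> simp only [le_min_iff, min_le_iff] <;> and_intros <;> omega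
  · rw [Params.capacityExpr]
    simp only [hd, hc', hr, hs]
    norm_cast
    simp only [e1, e2, e3, e6, e7, e9, sub_zero]
    clear hS hS' e1 e2 e3 e4 e5 e6 e7 e8 e9
    apply le_antisymm <;> simp only [le_min_iff, min_le_iff] <;> and_intros <;> omega

/-- Once the halves are cleared, this is a case distinction on the order of the four strengths; the
second WI-2 regime and the third WI-3 regime are separated by comparing `2 * nd` with `2 * ns + nc`.
-/
theorem exists_regime (P : Params) (hc : P.nc < P.nd) (hs : P.nc < P.ns) :
    P.RegimeWI1 ∨ P.RegimeWI2 ∨ P.RegimeA ∨ P.RegimeB ∨ P.RegimeC := by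
  have h1 : ((P.ns : ℝ) ≤ P.nd - (P.nc : ℝ) / 2) ↔ 2 * P.ns + P.nc ≤ 2 * P.nd := by
    rw [← Nat.cast_le (α := ℝ)]
    push_cast
    constructor <;> intro h <;> linarith
  have h2 : ((P.nd : ℝ) < P.ns + (P.nc : ℝ) / 2) ↔ 2 * P.nd < 2 * P.ns + P.nc := by
    rw [← Nat.cast_lt (α := ℝ)]
    push_cast
    constructor <;> intro h <;> linarith
  simp only [Params.RegimeWI1, Params.RegimeWI2, Params.RegimeA, Params.RegimeB, Params.RegimeC,
    h1, h2]
  omega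

end LDIRC

theorem mainTheorem8 (P : LDIRC.Params) (hWI : P.nc < P.nd) :
    (P.RegimeA → P.WI3Attains
      (min ((P.ns : ℝ) + P.nd - P.nc)
        (min (2 * (P.nd : ℝ) + P.nr - P.nc)
          (2 * max (P.nc : ℝ) ((P.nr : ℝ) + P.nd - P.nc))))) ∧
    (P.RegimeB → P.WI3Attains
      (min (2 * (P.nd : ℝ) - P.nc)
        (min (2 * max (P.ns : ℝ) ((P.nd : ℝ) - P.nc))
          (2 * max (P.nc : ℝ) ((P.nr : ℝ) + P.nd - P.nc))))) ∧
    (P.RegimeC → P.WI3Attains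
      (min (2 * (P.nd : ℝ) - P.nc)
        (2 * max ((P.nr : ℝ) + P.ns - P.nc) ((P.nd : ℝ) - P.nc)))) ∧
    (P.nc < P.ns →
      P.RegimeWI1 ∨ P.RegimeWI2 ∨ P.RegimeA ∨ P.RegimeB ∨ P.RegimeC) :=
  ⟨LDIRC.wi3Attains_regimeA P, LDIRC.wi3Attains_regimeB P hWI, LDIRC.wi3Attains_regimeC P hWI,
    LDIRC.exists_regime P hWI⟩
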